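/- For $\tau$ in the upper half plane $\mathbb{H}$ put $q=e^{2\pi i\tau}$, $q^{1/4}=e^{2\pi i\tau/4}$, $$X(\tau)=q^{1/4}\prod_{n=1}^{\infty}\frac{(1-q^{6n-1})(1-q^{6n-5})}{(1-q^{6n-2})(1-q^{6n-4})},\qquad w(\tau)=X(\tau)X(3\tau).$$ A modular equation of level $n$ for $w$ is an equation $F(X,Y)=0$ with $F\in\mathbb{C}[X,Y]$ irreducible and $F(w(\tau),w(n\tau))=0$ for all $\tau\in\mathbb{H}$. Let $p\geq 5$ be a prime. There is a modular equation $F_p(X,Y)=0$ of level $p$ for $w$ with $F_p=\sum_{0\le i,j\le p+1}C_{i,j}X^iY^j\in\mathbb{Q}[X,Y]$; the polynomial $F_p$ is irreducible over $\mathbb{C}$, and it is unique up to a nonzero constant factor: if $G(X,Y)=0$ is a modular equation of level $p$ for $w$, then $G=cF_p$ for some $c\in\mathbb{C}\setminus\{0\}$. Moreover $\deg_X F_p=\deg_Y F_p=p+1$, and 1. $C_{p+1,0}\neq 0$ and $C_{0,p+1}\neq 0$; 2. $C_{p+1,j}=C_{j,p+1}=0$ for all $j\in\{1,2,\ldots,p+1\}$;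 3. $C_{0,j}=C_{j,0}=0$ for all $j\in\{0,1,\ldots,p\}$. -/

import Mathlib

open Polynomial
open scoped UpperHalfPlane Polynomial.Bivariate

/-- The continued fraction of order six, through its product expansion
`X(τ) = q^{1/4} ∏_{n ≥ 1} (1 - q^{6n-1})(1 - q^{6n-5}) / ((1 - q^{6n-2})(1 - q^{6n-4}))`,
where `q^{1/4} = exp(2πiτ/4)` and `q = exp(2πiτ)`. The index is shifted to start at `n = 0`. -/
noncomputable def contFracX (τ : ℂ) : ℂ :=
  Complex.exp (2 * Real.pi * Complex.I * τ / 4) *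
    ∏' n : ℕ,
      ((1 - Complex.exp (2 * Real.pi * Complex.I * τ) ^ (6 * n + 5)) *
          (1 - Complex.exp (2 * Real.pi * Complex.I * τ) ^ (6 * n + 1))) /
        ((1 - Complex.exp (2 * Real.pi * Complex.I * τ) ^ (6 * n + 4)) *
          (1 - Complex.exp (2 * Real.pi * Complex.I * τ) ^ (6 * n + 2)))

/-- The function `w(τ) = X(τ) X(3τ)`, of interest for `τ` in the upper half plane. -/
noncomputable def wFun (τ : ℂ) : ℂ :=
  contFracX τ * contFracX (3 * τ)

/-- `F(X, Y) = 0` is a modular equation of level `n` for `w`: the polynomial `F` is irreducible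
in `ℂ[X, Y]` and `F(w(τ), w(nτ)) = 0` for all `τ` in the upper half plane. In `ℂ[X][Y]` the inner
variable is `X` and the outer one is `Y`. -/
def IsModularEquation (n : ℕ) (F : ℂ[X][Y]) : Prop :=
  Irreducible F ∧ ∀ τ : ℍ, F.evalEval (wFun τ) (wFun (n * τ)) = 0

/-- The coefficient `C_{i,j}` of `X ^ i * Y ^ j` in a polynomial `F` in two variables. -/
noncomputable def coeffXY (F : ℚ[X][Y]) (i j : ℕ) : ℚ :=
  (F.coeff j).coeff i

/-- The degree of `F(X, Y)` in `Y`. -/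
noncomputable def degY (F : ℚ[X][Y]) : ℕ :=
  F.natDegree

/-- The degree of `F(X, Y)` in `X`: the largest degree of a coefficient of a power of `Y`. -/
noncomputable def degX (F : ℚ[X][Y]) : ℕ :=
  F.support.sup fun j => (F.coeff j).natDegree

/-! Put T = 1/w. The product expansion makes T the eta quotient η(2z)²η(9z) / (η(z)η(18z)²), and the
3-dissection of the theta series ψ(q) = ∑ q^(n(n+1)/2) shows that T - 1 is an eta quotient as well
(`hauptT_eq_add_one`). Since η^24 is modular of weight 12, each γ in Γ₀(18) multiplies T and T - 1
by constants; T is not constant, so both constants are 1 (`hauptT_mob`). The orders of the eta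
factors at the cusps show that T has its only pole at i∞ and its only zero at the cusp 1/2. Hence an
invariant holomorphic function with poles at most at 1/2 is a polynomial in w
(`exists_polynomial_wFun`).

The p + 1 functions w(pz) and w((z + j)/p) are permuted by Γ₀(18). As p is prime to 18, they too
have poles only at cusps equivalent to 1/2. So ∏ (Y - w_i) = F(w, Y) for a polynomial F that is
monic of degree p + 1 in Y (`exists_modular_polynomial`). At i∞ all of w and the w_i tend to 0,
which kills the lower coefficients at X = 0. The w_i are distinct and permuted transitively, so F
divides every polynomial that vanishes at (w(z), w(pz)) (`dvd_of_vanishes`); irreducibility and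
uniqueness follow.

The relation also holds with the two functions exchanged (`Vanishes.swap`), so F(Y, X) is a constant
multiple of F(X, Y), and everything known about Y transfers to X. Rationality comes from the
rational q-expansion of w: a ℚ-linear retraction ℂ → ℚ applied to the coefficients of F yields
another vanishing polynomial, which must be F itself (`exists_rational_modular_equation`). -/

namespace ContFracSix

open Filter Topology Complex

/-- The infinite product `∏ (1 - x Q ^ n)` over `n ≥ 0`. -/
noncomputable def qProd (x Q : ℂ) : ℂ := ∏' n : ℕ, (1 - x * Q ^ n)

/-! ### Infinite products and the Euler product form of w. -/

section Products

variable {x Q : ℂ}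

theorem multipliable_qProd (hQ : ‖Q‖ < 1) : Multipliable fun n : ℕ => 1 - x * Q ^ n := by
  have := multipliable_one_add_of_summable (f := fun n : ℕ => -(x * Q ^ n)) (by
    simpa using (summable_geometric_of_lt_one (norm_nonneg _) hQ).mul_left ‖x‖)
  simpa [sub_eq_add_neg] using this

theorem tendsto_qProd (hQ : ‖Q‖ < 1) :
    Tendsto (fun N => ∏ n ∈ Finset.range N, (1 - x * Q ^ n)) atTop (𝓝 (qProd x Q)) :=
  (multipliable_qProd hQ).hasProd.tendsto_prod_nat

theorem qProd_ne_zero (hx : ‖x‖ < 1) (hQ : ‖Q‖ < 1) : qProd x Q ≠ 0 := by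
  have := tprod_one_add_ne_zero_of_summable (f := fun n : ℕ => -(x * Q ^ n)) (fun n h => by
    have h1 : x * Q ^ n = 1 := by linear_combination -h
    have h2 : ‖x‖ * ‖Q‖ ^ n = 1 := by simpa using congrArg norm h1
    have h3 : ‖Q‖ ^ n ≤ 1 := pow_le_one₀ (norm_nonneg _) hQ.le
    nlinarith [norm_nonneg x, norm_nonneg Q]) (by
    simpa using (summable_geometric_of_lt_one (norm_nonneg _) hQ).mul_left ‖x‖)
  simpa [sub_eq_add_neg, qProd] using this

theorem prod_range_mul_eq (f : ℕ → ℂ) (k N : ℕ) :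
    ∏ n ∈ Finset.range (k * N), f n = ∏ r ∈ Finset.range k, ∏ n ∈ Finset.range N, f (r + k * n) := by
  induction N with
  | zero => simp
  | succ N ih =>
    rw [mul_add, mul_one, Finset.prod_range_add, ih, ← Finset.prod_mul_distrib]
    refine Finset.prod_congr rfl fun r _ => ?_
    rw [Finset.prod_range_succ, add_comm r]

/-- Group the factors by the residue of the exponent modulo k; the finite identity passes to the
limit along multiples of k. -/
theorem qProd_split (hQ : ‖Q‖ < 1) {k : ℕ} (hk : 0 < k) (x : ℂ) :
    qProd x Q = ∏ r ∈ Finset.range k, qProd (x * Q ^ r) (Q ^ k) := by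
  have hQk : ‖Q ^ k‖ < 1 := by simpa using pow_lt_one₀ (norm_nonneg _) hQ hk.ne'
  have h1 := (tendsto_qProd (x := x) hQ).comp
    (tendsto_id.const_mul_atTop' (α := ℕ) hk : Tendsto (fun N => k * N) atTop atTop)
  have h2 : Tendsto (fun N => ∏ r ∈ Finset.range k, ∏ n ∈ Finset.range N,
      (1 - x * Q ^ r * (Q ^ k) ^ n)) atTop (𝓝 (∏ r ∈ Finset.range k, qProd (x * Q ^ r) (Q ^ k))) :=
    tendsto_finsetProd _ fun r _ => tendsto_qProd hQk
  refine tendsto_nhds_unique h1 (h2.congr fun N => ?_)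
  rw [Function.comp_apply, prod_range_mul_eq]
  refine Finset.prod_congr rfl fun r _ => Finset.prod_congr rfl fun n _ => ?_
  rw [pow_add, pow_mul]
  ring

theorem qProd_succ (hQ : ‖Q‖ < 1) (x : ℂ) : qProd x Q = (1 - x) * qProd (x * Q) Q := by
  have h1 := (tendsto_qProd (x := x) hQ).comp (tendsto_add_atTop_nat 1)
  refine tendsto_nhds_unique h1 (((tendsto_qProd (x := x * Q) hQ).const_mul (1 - x)).congr
    fun N => ?_)
  rw [Function.comp_apply, Finset.prod_range_succ']
  simp only [pow_succ', mul_assoc]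
  simp [mul_comm]

theorem qProd_neg_mul (hQ : ‖Q‖ < 1) (x : ℂ) :
    qProd (-x) Q * qProd x Q = qProd (x ^ 2) (Q ^ 2) := by
  have hQ2 : ‖Q ^ 2‖ < 1 := by simpa using pow_lt_one₀ (norm_nonneg _) hQ two_ne_zero
  refine tendsto_nhds_unique (((tendsto_qProd (x := -x) hQ).mul (tendsto_qProd (x := x) hQ)).congr
    fun N => ?_) (tendsto_qProd (x := x ^ 2) hQ2)
  rw [← Finset.prod_mul_distrib]
  exact Finset.prod_congr rfl fun n _ => by ring

/-- Euler's product `∏ (1 - q ^ n)` over `n ≥ 1`. -/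
noncomputable def eulerProd (q : ℂ) : ℂ := qProd q q

theorem eulerProd_eq (q : ℂ) : eulerProd q = ∏' n : ℕ, (1 - q ^ (n + 1)) := by
  simp [eulerProd, qProd, pow_succ']

theorem eulerProd_ne_zero (hQ : ‖Q‖ < 1) : eulerProd Q ≠ 0 := qProd_ne_zero hQ hQ

theorem qProd_neg_self (hQ : ‖Q‖ < 1) : qProd (-Q) Q = eulerProd (Q ^ 2) / eulerProd Q := by
  rw [eq_div_iff (eulerProd_ne_zero hQ)]
  exact qProd_neg_mul hQ Q

theorem norm_pow_lt_one {q : ℂ} (hq : ‖q‖ < 1) {k : ℕ} (hk : k ≠ 0) : ‖q ^ k‖ < 1 := by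
  simpa using pow_lt_one₀ (norm_nonneg _) hq hk

/-- Splitting each Euler product into residue classes modulo 6, everything cancels except the
classes 1 and 5 over 2 and 4. -/
theorem tprod_contFrac (hq : ‖Q‖ < 1) :
    (∏' n : ℕ, ((1 - Q ^ (6 * n + 5)) * (1 - Q ^ (6 * n + 1))) /
        ((1 - Q ^ (6 * n + 4)) * (1 - Q ^ (6 * n + 2)))) =
      eulerProd Q * eulerProd (Q ^ 6) ^ 2 / (eulerProd (Q ^ 2) ^ 2 * eulerProd (Q ^ 3)) := by
  have h6 : ‖Q ^ 6‖ < 1 := norm_pow_lt_one hq (by norm_num)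
  have hp (r : ℕ) (hr : r ≠ 0) : qProd (Q ^ r) (Q ^ 6) ≠ 0 :=
    qProd_ne_zero (norm_pow_lt_one hq hr) h6
  have key (r : ℕ) : Multipliable fun n : ℕ => 1 - Q ^ (6 * n + r) :=
    (multipliable_qProd (x := Q ^ r) h6).congr fun n => by rw [pow_add, pow_mul]; ring
  have keyv (r : ℕ) : ∏' n : ℕ, (1 - Q ^ (6 * n + r)) = qProd (Q ^ r) (Q ^ 6) := by
    refine tprod_congr fun n => ?_
    rw [pow_add, pow_mul]; ring
  have hd (r s : ℕ) : HasProd (fun n : ℕ => (1 - Q ^ (6 * n + r)) * (1 - Q ^ (6 * n + s)))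
      (qProd (Q ^ r) (Q ^ 6) * qProd (Q ^ s) (Q ^ 6)) := by
    simpa only [keyv] using (key r).hasProd.mul (key s).hasProd
  have hmain := (hd 5 1).div₀ (hd 4 2) (mul_ne_zero (hp 4 (by norm_num)) (hp 2 (by norm_num)))
  rw [hmain.tprod_eq]
  have e1 : eulerProd Q = qProd (Q ^ 1) (Q ^ 6) * qProd (Q ^ 2) (Q ^ 6) * qProd (Q ^ 3) (Q ^ 6) *
      qProd (Q ^ 4) (Q ^ 6) * qProd (Q ^ 5) (Q ^ 6) * qProd (Q ^ 6) (Q ^ 6) := by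
    rw [eulerProd, qProd_split hq (k := 6) (by norm_num)]
    simp only [Finset.prod_range_succ, Finset.prod_range_zero, one_mul, ← pow_succ']
  have e2 : eulerProd (Q ^ 2) = qProd (Q ^ 2) (Q ^ 6) * qProd (Q ^ 4) (Q ^ 6) *
      qProd (Q ^ 6) (Q ^ 6) := by
    rw [eulerProd, qProd_split (norm_pow_lt_one hq two_ne_zero) (k := 3) (by norm_num)]
    simp only [Finset.prod_range_succ, Finset.prod_range_zero, one_mul, ← pow_mul, ← pow_add]
  have e3 : eulerProd (Q ^ 3) = qProd (Q ^ 3) (Q ^ 6) * qProd (Q ^ 6) (Q ^ 6) := by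
    rw [eulerProd, qProd_split (norm_pow_lt_one hq three_ne_zero) (k := 2) (by norm_num)]
    simp only [Finset.prod_range_succ, Finset.prod_range_zero, one_mul, ← pow_mul, ← pow_add]
  have e6 : eulerProd (Q ^ 6) = qProd (Q ^ 6) (Q ^ 6) := rfl
  rw [e1, e2, e3, e6]
  have h2 := hp 2 (by norm_num)
  have h3 := hp 3 (by norm_num)
  have h4 := hp 4 (by norm_num)
  have h6' := hp 6 (by norm_num)
  field_simp

end Products

/-- The nome `exp (2πiτ)`. -/
noncomputable def nome (τ : ℂ) : ℂ := Complex.exp (2 * Real.pi * Complex.I * τ)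

theorem norm_nome (τ : ℂ) : ‖nome τ‖ = Real.exp (-2 * Real.pi * τ.im) := by
  simp [nome, Complex.norm_exp]

theorem norm_nome_lt_one {τ : ℂ} (h : 0 < τ.im) : ‖nome τ‖ < 1 := by
  rw [norm_nome, Real.exp_lt_one_iff]
  have := mul_pos Real.pi_pos h
  linarith

theorem nome_nat_mul (k : ℕ) (τ : ℂ) : nome (k * τ) = nome τ ^ k := by
  rw [nome, nome, ← Complex.exp_nat_mul]
  congr 1
  ring

/-- The factors at q³ and q⁶ cancel between X(τ) and X(3τ), and q^(1/4) q^(3/4) = q. -/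
theorem wFun_eq {τ : ℂ} (h : 0 < τ.im) :
    wFun τ = nome τ * (eulerProd (nome τ) * eulerProd (nome τ ^ 18) ^ 2 /
      (eulerProd (nome τ ^ 2) ^ 2 * eulerProd (nome τ ^ 9))) := by
  have hq := norm_nome_lt_one h
  have h3 : Complex.exp (2 * Real.pi * Complex.I * (3 * τ)) = nome τ ^ 3 := by
    simpa [nome] using nome_nat_mul 3 τ
  have h1 : Complex.exp (2 * Real.pi * Complex.I * τ) = nome τ := rfl
  rw [wFun, contFracX, contFracX, h3, h1, tprod_contFrac hq,
    tprod_contFrac (norm_pow_lt_one hq three_ne_zero)]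
  have he : Complex.exp (2 * Real.pi * Complex.I * τ / 4) *
      Complex.exp (2 * Real.pi * Complex.I * (3 * τ) / 4) = nome τ := by
    rw [← Complex.exp_add, nome]
    congr 1
    ring
  have hp (r : ℕ) (hr : r ≠ 0) : eulerProd (nome τ ^ r) ≠ 0 :=
    eulerProd_ne_zero (norm_pow_lt_one hq hr)
  have n2 := hp 2 (by norm_num)
  have n3 := hp 3 (by norm_num)
  have n6 := hp 6 (by norm_num)
  have n9 := hp 9 (by norm_num)
  simp only [← pow_mul]
  norm_num only
  rw [mul_mul_mul_comm, he]
  field_simp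

end ContFracSix

namespace ContFracSix

open Filter Topology Complex

/-! ### Jacobi's triple product from the finite q-binomial theorem. -/

section TripleProduct

/-- The number `n (n - 1) / 2` for an integer `n`. -/
def tri (n : ℤ) : ℕ := (n * (n - 1) / 2).toNat

theorem two_mul_tri (n : ℤ) : 2 * (tri n : ℤ) = n * (n - 1) := by
  have he : Even (n * (n - 1)) := by
    have := Int.even_mul_succ_self (n - 1)
    rwa [sub_add_cancel, mul_comm] at this
  have h0 : 0 ≤ n * (n - 1) := by
    rcases le_or_gt n 0 with h | h <;> nlinarith
  rw [tri, Int.toNat_of_nonneg (Int.ediv_nonneg h0 (by norm_num))]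
  exact Int.two_mul_ediv_two_of_even he

theorem two_mul_choose_two (m : ℕ) : 2 * (m.choose 2 : ℤ) = m * (m - 1) := by
  have h := two_mul_tri m
  have h2 : m.choose 2 = tri m := by
    rw [tri, Nat.choose_two_right]
    rcases m with _ | m
    · simp
    · push_cast
      simp only [add_sub_cancel_right]
      norm_cast
  rw [h2, h]

theorem tri_natCast (m : ℕ) : tri m = m.choose 2 := by
  have h1 := two_mul_tri m
  have h2 := two_mul_choose_two m
  omega

/-- The finite product `(1 - Q) ⋯ (1 - Q ^ n)`. -/
noncomputable def qPoch (Q : ℂ) (n : ℕ) : ℂ := ∏ k ∈ Finset.range n, (1 - Q ^ (k + 1))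

/-- The Gaussian binomial coefficient, zero when out of range. -/
noncomputable def gaussBinom (Q : ℂ) (M m : ℕ) : ℂ :=
  if m ≤ M then qPoch Q M * ((qPoch Q m)⁻¹ * (qPoch Q (M - m))⁻¹) else 0

variable {Q : ℂ}

theorem qPoch_ne_zero (hQ : ‖Q‖ < 1) (n : ℕ) : qPoch Q n ≠ 0 := by
  refine Finset.prod_ne_zero_iff.2 fun k _ h => ?_
  have h1 : Q ^ (k + 1) = 1 := by linear_combination -h
  have h2 := norm_pow_lt_one hQ k.succ_ne_zero
  rw [h1] at h2
  simp at h2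

theorem qPoch_succ (n : ℕ) : qPoch Q (n + 1) = qPoch Q n * (1 - Q ^ (n + 1)) :=
  Finset.prod_range_succ _ _

theorem tendsto_qPoch (hQ : ‖Q‖ < 1) : Tendsto (qPoch Q) atTop (𝓝 (eulerProd Q)) := by
  refine (tendsto_qProd (x := Q) hQ).congr fun N => ?_
  simp [qPoch, pow_succ']

theorem gaussBinom_zero_right (hQ : ‖Q‖ < 1) (M : ℕ) : gaussBinom Q M 0 = 1 := by
  have := qPoch_ne_zero hQ M
  have h0 : qPoch Q 0 = 1 := by simp [qPoch]
  simp [gaussBinom, h0, this]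

/-- The q-Pascal rule, from 1 - Q^(M+1) = (1 - Q^(M-m)) + Q^(M-m) (1 - Q^(m+1)). -/
theorem gaussBinom_succ_succ (hQ : ‖Q‖ < 1) {M m : ℕ} (h : m ≤ M) :
    gaussBinom Q (M + 1) (m + 1) = gaussBinom Q M (m + 1) + Q ^ (M - m) * gaussBinom Q M m := by
  have h0 : qPoch Q 0 = 1 := by simp [qPoch]
  have n1 := qPoch_ne_zero hQ m
  have n1' := qPoch_ne_zero hQ (m + 1)
  rcases h.eq_or_lt with rfl | h
  · simp [gaussBinom, h0, n1, n1']
  · obtain ⟨d, rfl⟩ := Nat.exists_eq_add_of_lt h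
    have e1 : m + d + 1 + 1 - (m + 1) = d + 1 := by omega
    have e2 : m + d + 1 - (m + 1) = d := by omega
    have e3 : m + d + 1 - m = d + 1 := by omega
    have n2 := qPoch_ne_zero hQ d
    have n2' := qPoch_ne_zero hQ (d + 1)
    rw [gaussBinom, gaussBinom, gaussBinom, if_pos (by omega), if_pos (by omega),
      if_pos (by omega), e1, e2, e3]
    rw [qPoch_succ] at n1' n2'
    have n3 := (mul_ne_zero_iff.1 n1').2
    have n4 := (mul_ne_zero_iff.1 n2').2
    rw [qPoch_succ (m + d + 1), qPoch_succ m, qPoch_succ d]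
    field_simp
    ring

theorem prod_one_add_eq_sum (hQ : ‖Q‖ < 1) (x : ℂ) (M : ℕ) :
    ∏ k ∈ Finset.range M, (1 + x * Q ^ k) =
      ∑ m ∈ Finset.range (M + 1), Q ^ m.choose 2 * gaussBinom Q M m * x ^ m := by
  induction M with
  | zero => simp [gaussBinom_zero_right hQ]
  | succ M ih =>
    have hc (m : ℕ) : (m + 1).choose 2 = m + m.choose 2 := by
      rw [Nat.choose_succ_succ' m 1, Nat.choose_one_right]
    have h1 : ∑ m ∈ Finset.range (M + 1), Q ^ m.choose 2 * gaussBinom Q M m * x ^ m =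
        (∑ m ∈ Finset.range (M + 1),
          Q ^ (m + 1).choose 2 * gaussBinom Q M (m + 1) * x ^ (m + 1)) + 1 := by
      have := Finset.sum_range_succ'
        (fun m => Q ^ m.choose 2 * gaussBinom Q M m * x ^ m) (M + 1)
      rw [Finset.sum_range_succ] at this
      have h0 : gaussBinom Q M (M + 1) = 0 := if_neg (by omega)
      simpa [gaussBinom_zero_right hQ, h0] using this
    rw [Finset.prod_range_succ, ih, mul_add, mul_one, Finset.sum_range_succ' _ (M + 1), Finset.sum_mul]
    nth_rewrite 1 [h1]
    rw [add_right_comm, ← Finset.sum_add_distrib]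
    congr 1
    · refine Finset.sum_congr rfl fun m hm => ?_
      have hm' : m ≤ M := Nat.lt_succ_iff.1 (Finset.mem_range.1 hm)
      rw [gaussBinom_succ_succ hQ hm', hc]
      have : Q ^ M = Q ^ m * Q ^ (M - m) := by rw [← pow_add]; congr 1; omega
      rw [this]
      ring
    · simp [gaussBinom_zero_right hQ]

/-- This uniform bound supplies the dominating series in `hasSum_triple_product`. -/
theorem exists_norm_gaussBinom_le (hQ : ‖Q‖ < 1) : ∃ C, ∀ M m, ‖gaussBinom Q M m‖ ≤ C := by
  obtain ⟨C₁, h₁⟩ := (Metric.isBounded_range_of_tendsto _ (tendsto_qPoch hQ)).exists_norm_le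
  obtain ⟨C₂, h₂⟩ := (Metric.isBounded_range_of_tendsto _
    ((tendsto_qPoch hQ).inv₀ (eulerProd_ne_zero hQ))).exists_norm_le
  have h₁' (n) : ‖qPoch Q n‖ ≤ C₁ := h₁ _ ⟨n, rfl⟩
  have h₂' (n) : ‖(qPoch Q n)⁻¹‖ ≤ C₂ := h₂ _ ⟨n, rfl⟩
  have p₁ := (norm_nonneg _).trans (h₁' 0)
  have p₂ := (norm_nonneg _).trans (h₂' 0)
  refine ⟨C₁ * (C₂ * C₂), fun M m => ?_⟩
  rw [gaussBinom]
  split_ifs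
  · rw [norm_mul, norm_mul]
    exact mul_le_mul (h₁' _) (mul_le_mul (h₂' _) (h₂' _) (norm_nonneg _) p₂)
      (by positivity) p₁
  · rw [norm_zero]; positivity

/-- Pull z Q^(k-N) out of each factor 1 + z Q^(k-N); the extracted powers of Q add up to 1 + ⋯ + N =
`tri (-N)`. -/
theorem prod_shift_eq {z : ℂ} (hz : z ≠ 0) (hQ0 : Q ≠ 0) (N : ℕ) :
    Q ^ tri (-N) * ∏ k ∈ Finset.range N, (1 + z * (Q ^ N)⁻¹ * Q ^ k) =
      z ^ N * ∏ k ∈ Finset.range N, (1 + z⁻¹ * Q ^ (k + 1)) := by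
  have h1 : Q ^ tri (-N) = ∏ k ∈ Finset.range N, Q ^ (k + 1) := by
    rw [Finset.prod_pow_eq_pow_sum]
    congr 1
    have := two_mul_tri (-N)
    have h2 : (∑ i ∈ Finset.range N, (i + 1)) = (N + 1).choose 2 := by
      rw [Nat.choose_two_right, ← Finset.sum_range_id, Finset.sum_range_succ' (fun i => i)]
      simp
    have h3 := two_mul_choose_two (N + 1)
    rw [h2]
    push_cast at h3
    have : 2 * (tri (-N) : ℤ) = 2 * ((N + 1).choose 2 : ℤ) := by rw [this, h3]; ring
    omega
  have h4 : z ^ N = ∏ k ∈ Finset.range N, z := by simp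
  rw [h1, h4, ← Finset.prod_range_reflect, ← Finset.prod_mul_distrib, ← Finset.prod_mul_distrib,
    ← Finset.prod_range_reflect]
  refine Finset.prod_congr rfl fun k hk => ?_
  have hk := Finset.mem_range.1 hk
  have e1 : N - 1 - (N - 1 - k) = k := by omega
  have e2 : Q ^ N = Q ^ (N - 1 - k) * Q ^ (k + 1) := by rw [← pow_add]; congr 1; omega
  rw [e1, e2]
  field_simp
  ring

theorem finite_triple_product (hQ : ‖Q‖ < 1) (hQ0 : Q ≠ 0) {z : ℂ} (hz : z ≠ 0) (N : ℕ) :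
    ∑ m ∈ Finset.range (2 * N + 1),
      z ^ ((m : ℤ) - N) * Q ^ tri ((m : ℤ) - N) * gaussBinom Q (2 * N) m =
    (∏ k ∈ Finset.range N, (1 + z * Q ^ k)) * ∏ k ∈ Finset.range N, (1 + z⁻¹ * Q ^ (k + 1)) := by
  have h := prod_one_add_eq_sum hQ (z * (Q ^ N)⁻¹) (2 * N)
  have h2 := prod_shift_eq hz hQ0 N
  have hs : ∏ k ∈ Finset.range N, (1 + z * (Q ^ N)⁻¹ * Q ^ (N + k)) =
      ∏ k ∈ Finset.range N, (1 + z * Q ^ k) := by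
    refine Finset.prod_congr rfl fun k _ => ?_
    rw [pow_add]
    field_simp
  rw [two_mul, Finset.prod_range_add, hs, ← two_mul] at h
  have hzN : z ^ N ≠ 0 := pow_ne_zero _ hz
  refine mul_left_cancel₀ hzN ?_
  have : z ^ N * ((∏ k ∈ Finset.range N, (1 + z * Q ^ k)) *
      ∏ k ∈ Finset.range N, (1 + z⁻¹ * Q ^ (k + 1))) = Q ^ tri (-N) *
      ∑ m ∈ Finset.range (2 * N + 1), Q ^ m.choose 2 * gaussBinom Q (2 * N) m *
        (z * (Q ^ N)⁻¹) ^ m := by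
    rw [← h]
    linear_combination (-∏ k ∈ Finset.range N, (1 + z * Q ^ k)) * h2
  rw [this, Finset.mul_sum, Finset.mul_sum]
  refine Finset.sum_congr rfl fun m _ => ?_
  have e1 : z ^ ((m : ℤ) - N) = z ^ m * (z ^ N)⁻¹ := by
    rw [zpow_sub₀ hz, zpow_natCast, zpow_natCast, div_eq_mul_inv]
  have e2 : Q ^ tri ((m : ℤ) - N) * Q ^ (N * m) = Q ^ m.choose 2 * Q ^ tri (-N) := by
    rw [← pow_add, ← pow_add]
    congr 1
    have a1 := two_mul_tri ((m : ℤ) - N)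
    have a2 := two_mul_tri (-N)
    have a3 := two_mul_choose_two m
    zify
    linarith
  rw [e1, mul_pow, inv_pow, ← pow_mul]
  have hQN : Q ^ (N * m) ≠ 0 := pow_ne_zero _ hQ0
  field_simp
  linear_combination gaussBinom Q (2 * N) m * e2

theorem summable_pow_mul_pow_choose {x r : ℝ} (hx : 0 < x) (hr0 : 0 < r) (hr : r < 1) :
    Summable fun n : ℕ => x ^ n * r ^ n.choose 2 := by
  refine summable_of_ratio_test_tendsto_lt_one (l := 0) one_pos
    (Eventually.of_forall fun n => by positivity) ?_
  have h := (tendsto_pow_atTop_nhds_zero_of_lt_one hr0.le hr).const_mul x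
  rw [mul_zero] at h
  refine h.congr fun n => ?_
  have hc : (n + 1).choose 2 = n + n.choose 2 := by
    rw [Nat.choose_succ_succ' n 1, Nat.choose_one_right]
  rw [Real.norm_of_nonneg (by positivity), Real.norm_of_nonneg (by positivity), hc]
  field_simp
  ring

theorem summable_zpow_mul_pow_tri (hQ : ‖Q‖ < 1) (hQ0 : Q ≠ 0) {z : ℂ} (hz : z ≠ 0) :
    Summable fun n : ℤ => ‖z ^ n * Q ^ tri n‖ := by
  have hQ' : 0 < ‖Q‖ := norm_pos_iff.2 hQ0
  have hz' : 0 < ‖z‖ := norm_pos_iff.2 hz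
  refine Summable.of_nat_of_neg ?_ ?_
  · refine (summable_pow_mul_pow_choose hz' hQ' hQ).congr fun n => ?_
    simp [tri_natCast]
  · refine (summable_pow_mul_pow_choose (div_pos hQ' hz') hQ' hQ).congr fun n => ?_
    have h : tri (-n) = n + n.choose 2 := by
      have a2 := two_mul_tri (-n)
      have a3 := two_mul_choose_two n
      zify
      linarith
    rw [h]
    simp [pow_add, div_pow]
    field_simp

/-- **Jacobi's triple product identity**. -/
theorem hasSum_triple_product (hQ : ‖Q‖ < 1) (hQ0 : Q ≠ 0) {z : ℂ} (hz : z ≠ 0) :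
    HasSum (fun n : ℤ => z ^ n * Q ^ tri n) (qProd (-z) Q * qProd (-(Q / z)) Q * eulerProd Q) := by
  obtain ⟨C, hC⟩ := exists_norm_gaussBinom_le hQ
  have hsum := summable_zpow_mul_pow_tri hQ hQ0 hz
  -- The terms of `finite_triple_product`, indexed by m - N and extended by zero to ℤ. As N grows
  -- the Gaussian binomial tends to 1 / `eulerProd Q`, and dominated convergence applies.
  let F : ℕ → ℤ → ℂ := fun N n =>
    if 0 ≤ n + N then z ^ n * Q ^ tri n * gaussBinom Q (2 * N) (n + N).toNat else 0
  have hF (N : ℕ) : ∑' n, F N n = (∏ k ∈ Finset.range N, (1 + z * Q ^ k)) *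
      ∏ k ∈ Finset.range N, (1 + z⁻¹ * Q ^ (k + 1)) := by
    rw [← finite_triple_product hQ hQ0 hz]
    have hinj : Function.Injective fun m : ℕ => (m : ℤ) - N := fun a b h => by
      simpa using h
    rw [tsum_eq_sum (s := (Finset.range (2 * N + 1)).map ⟨_, hinj⟩), Finset.sum_map]
    · refine Finset.sum_congr rfl fun m _ => ?_
      simp [F]
    · intro n hn
      simp only [F]
      split_ifs with h
      · have : ¬ (n + N).toNat ≤ 2 * N := fun hle => hn (by
          simp only [Finset.mem_map, Finset.mem_range, Function.Embedding.coeFn_mk]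
          exact ⟨(n + N).toNat, by omega, by omega⟩)
        simp [gaussBinom, this]
      · rfl
  have hlim : Tendsto (fun N => ∑' n, F N n) atTop
      (𝓝 (∑' n : ℤ, z ^ n * Q ^ tri n * (eulerProd Q)⁻¹)) := by
    refine tendsto_tsum_of_dominated_convergence (bound := fun n => ‖z ^ n * Q ^ tri n‖ * C)
      (hsum.mul_right C) (fun n => ?_) (Eventually.of_forall fun N n => ?_)
    · have hN : Tendsto (fun N : ℕ => gaussBinom Q (2 * N) (n + N).toNat) atTop
          (𝓝 (eulerProd Q)⁻¹) := by
        have t0 := tendsto_qPoch hQ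
        have t1 := t0.inv₀ (eulerProd_ne_zero hQ)
        have s1 : Tendsto (fun N : ℕ => 2 * N) atTop atTop :=
          tendsto_atTop_mono (fun N => Nat.le_mul_of_pos_left N two_pos) tendsto_id
        have s2 : Tendsto (fun N : ℕ => (n + N).toNat) atTop atTop := by
          refine tendsto_atTop.2 fun b => ?_
          filter_upwards [eventually_ge_atTop (b + n.natAbs)] with N hN
          omega
        have s3 : Tendsto (fun N : ℕ => 2 * N - (n + N).toNat) atTop atTop := by
          refine tendsto_atTop.2 fun b => ?_
          filter_upwards [eventually_ge_atTop (b + n.natAbs)] with N hN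
          omega
        have t2 := (t0.comp s1).mul ((t1.comp s2).mul (t1.comp s3))
        have hE := eulerProd_ne_zero hQ
        have e : eulerProd Q * ((eulerProd Q)⁻¹ * (eulerProd Q)⁻¹) = (eulerProd Q)⁻¹ := by
          field_simp
        rw [e] at t2
        refine t2.congr' ?_
        filter_upwards [eventually_ge_atTop n.natAbs] with N hN
        have : (n + N).toNat ≤ 2 * N := by omega
        simp [gaussBinom, this]
      refine (hN.const_mul (z ^ n * Q ^ tri n)).congr' ?_
      filter_upwards [eventually_ge_atTop n.natAbs] with N hN
      have : 0 ≤ n + N := by omega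
      simp [F, this]
    · simp only [F]
      split_ifs
      · rw [norm_mul]
        exact mul_le_mul_of_nonneg_left (hC _ _) (norm_nonneg _)
      · rw [norm_zero]
        exact mul_nonneg (norm_nonneg _) ((norm_nonneg _).trans (hC 0 0))
  have hprod : Tendsto (fun N => ∑' n, F N n) atTop (𝓝 (qProd (-z) Q * qProd (-(Q / z)) Q)) := by
    refine ((tendsto_qProd (x := -z) hQ).mul (tendsto_qProd (x := -(Q / z)) hQ)).congr fun N => ?_
    rw [hF]
    congr 1 <;> refine Finset.prod_congr rfl fun k _ => ?_
    · ring
    · rw [pow_succ]; field_simp; ring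
  have huniq := tendsto_nhds_unique hlim hprod
  rw [tsum_mul_right, ← div_eq_mul_inv, div_eq_iff (eulerProd_ne_zero hQ)] at huniq
  rw [← huniq]
  exact hsum.of_norm.hasSum

end TripleProduct

end ContFracSix

namespace ContFracSix

open Filter Topology Complex

/-! ### The 3-dissection of the theta series ψ. -/

section Identity

variable {q : ℂ}

theorem tsum_int_three {f : ℤ → ℂ} (hf : Summable f) :
    ∑' n, f n = (∑' m, f (3 * m) + ∑' m, f (3 * m + 1)) + ∑' m, f (3 * m + 2) := by
  have h (r : ℤ) : Summable fun m : ℤ => f (3 * m + r) :=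
    hf.comp_injective fun a b hab => by simpa using hab
  have h0 : Summable fun m : ℤ => f (3 * m) := by simpa using h 0
  have hp : Summable fun x : ℤ × Fin 3 => f ((Int.divModEquiv 3).symm x) :=
    (Int.divModEquiv 3).symm.summable_iff.2 hf
  rw [← (Int.divModEquiv 3).symm.tsum_eq f, Summable.tsum_prod hp,
    ← Summable.tsum_add h0 (h 1), ← Summable.tsum_add (h0.add (h 1)) (h 2)]
  refine tsum_congr fun m => ?_
  rw [tsum_fintype, Fin.sum_univ_three]
  simp [Int.divModEquiv, mul_comm]

/-- The triple product at z = 1, whose first factor is 1 - (-1) = 2. Over ℤ every triangular number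
occurs twice. -/
theorem hasSum_theta (hq : ‖q‖ < 1) (hq0 : q ≠ 0) :
    HasSum (fun n : ℤ => q ^ tri n) (2 * (eulerProd (q ^ 2) ^ 2 / eulerProd q)) := by
  have h := hasSum_triple_product hq hq0 one_ne_zero
  have hE := eulerProd_ne_zero hq
  rw [qProd_succ hq (-1), div_one, neg_one_mul, qProd_neg_self hq] at h
  convert h using 1
  · simp
  · field_simp; ring

/-- The triple product with base q⁹: z = q³ and z = q⁶ exchange z and q⁹/z, so the two sums agree.
-/
theorem hasSum_theta_three (hq : ‖q‖ < 1) (hq0 : q ≠ 0) {r : ℕ} (hr : r = 3 ∨ r = 6) :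
    HasSum (fun n : ℤ => (q ^ r) ^ n * (q ^ 9) ^ tri n)
      (eulerProd (q ^ 6) * eulerProd (q ^ 9) ^ 2 / (eulerProd (q ^ 3) * eulerProd (q ^ 18))) := by
  have h9 : ‖q ^ 9‖ < 1 := norm_pow_lt_one hq (by norm_num)
  have h3 : ‖q ^ 3‖ < 1 := norm_pow_lt_one hq (by norm_num)
  have h := hasSum_triple_product h9 (pow_ne_zero _ hq0) (pow_ne_zero r hq0)
  have e3 := eulerProd_ne_zero h3
  have e9 := eulerProd_ne_zero h9
  have e18 := eulerProd_ne_zero (norm_pow_lt_one hq (k := 18) (by norm_num))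
  have k9 := qProd_neg_self h9
  have k3 := qProd_neg_self h3
  have hsp : qProd (-q ^ 3) (q ^ 3) =
      qProd (-q ^ 3) (q ^ 9) * qProd (-q ^ 6) (q ^ 9) * qProd (-q ^ 9) (q ^ 9) := by
    rw [qProd_split h3 (k := 3) (by norm_num)]
    simp only [Finset.prod_range_succ, Finset.prod_range_zero, one_mul, ← pow_mul, neg_mul,
      ← pow_add]
  have e18' : q ^ 18 = (q ^ 9) ^ 2 := by ring
  have e6' : q ^ 6 = (q ^ 3) ^ 2 := by ring
  have n : qProd (-q ^ 9) (q ^ 9) ≠ 0 := qProd_ne_zero (by simpa using h9) h9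
  have key : qProd (-q ^ 3) (q ^ 9) * qProd (-q ^ 6) (q ^ 9) * eulerProd (q ^ 9) =
      eulerProd (q ^ 6) * eulerProd (q ^ 9) ^ 2 / (eulerProd (q ^ 3) * eulerProd (q ^ 18)) := by
    rw [hsp, ← e6'] at k3
    rw [← e18'] at k9
    rw [k9] at k3
    field_simp at k3 ⊢
    linear_combination k3
  rw [← key]
  rcases hr with rfl | rfl
  · have : q ^ 9 / q ^ 3 = q ^ 6 := by field_simp
    rwa [this] at h
  · have : q ^ 9 / q ^ 6 = q ^ 3 := by field_simp
    rw [this] at h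
    rwa [mul_comm (qProd (-q ^ 3) (q ^ 9))]

/-- Sort the exponents `tri n` by n modulo 3: the classes 0 and 1 give equal sums, and the class 2
gives q times the theta series at q⁹. All sums carry a factor 2, removed at the end. -/
theorem theta_dissection (hq : ‖q‖ < 1) (hq0 : q ≠ 0) :
    eulerProd (q ^ 2) ^ 2 / eulerProd q =
      eulerProd (q ^ 6) * eulerProd (q ^ 9) ^ 2 / (eulerProd (q ^ 3) * eulerProd (q ^ 18)) +
        q * (eulerProd (q ^ 18) ^ 2 / eulerProd (q ^ 9)) := by
  have h := hasSum_theta hq hq0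
  have h9 := hasSum_theta (norm_pow_lt_one hq (k := 9) (by norm_num)) (pow_ne_zero _ hq0)
  have hs := tsum_int_three h.summable
  have c0 : ∀ m : ℤ, q ^ tri (3 * m) = (q ^ 3) ^ m * (q ^ 9) ^ tri m := fun m => by
    rw [← zpow_natCast, ← zpow_natCast, ← zpow_natCast, ← zpow_natCast, ← zpow_mul, ← zpow_mul,
      ← zpow_add₀ hq0]
    congr 1
    have a1 := two_mul_tri (3 * m)
    have a2 := two_mul_tri m
    push_cast
    linarith
  have c1 : ∀ m : ℤ, q ^ tri (3 * m + 1) = (q ^ 6) ^ m * (q ^ 9) ^ tri m := fun m => by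
    rw [← zpow_natCast, ← zpow_natCast, ← zpow_natCast, ← zpow_natCast, ← zpow_mul, ← zpow_mul,
      ← zpow_add₀ hq0]
    congr 1
    have a1 := two_mul_tri (3 * m + 1)
    have a2 := two_mul_tri m
    push_cast
    linarith
  have c2 : ∀ m : ℤ, q ^ tri (3 * m + 2) = q * (q ^ 9) ^ tri (m + 1) := fun m => by
    rw [← pow_mul, ← pow_succ']
    congr 1
    have a1 := two_mul_tri (3 * m + 2)
    have a2 := two_mul_tri (m + 1)
    zify
    linarith
  have hshift : ∑' m : ℤ, (q ^ 9) ^ tri (m + 1) = ∑' m : ℤ, (q ^ 9) ^ tri m :=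
    (Equiv.addRight (1 : ℤ)).tsum_eq fun m => (q ^ 9) ^ tri m
  rw [h.tsum_eq, tsum_congr c0, tsum_congr c1, tsum_congr c2, tsum_mul_left,
    hshift, h9.tsum_eq,
    (hasSum_theta_three hq hq0 (Or.inl rfl)).tsum_eq,
    (hasSum_theta_three hq hq0 (Or.inr rfl)).tsum_eq, ← pow_mul] at hs
  norm_num only at hs
  linear_combination hs / 2

end Identity

/-! ### The eta quotients T and T - 1, and their behaviour at i∞. -/

/-- The reciprocal of `w` as an eta quotient. -/
noncomputable def hauptT (z : ℂ) : ℂ :=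
  ModularForm.eta (2 * z) ^ 2 * ModularForm.eta (9 * z) /
    (ModularForm.eta z * ModularForm.eta (18 * z) ^ 2)

/-- The eta quotient equal to `hauptT - 1`. -/
noncomputable def hauptU (z : ℂ) : ℂ :=
  ModularForm.eta (6 * z) * ModularForm.eta (9 * z) ^ 3 /
    (ModularForm.eta (3 * z) * ModularForm.eta (18 * z) ^ 3)

theorem eta_eq (z : ℂ) :
    ModularForm.eta z = Complex.exp (2 * Real.pi * Complex.I * z / 24) * eulerProd (nome z) := by
  rw [ModularForm.eta, eulerProd_eq]
  simp [ModularForm.eta_q, Function.Periodic.qParam, nome]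

theorem eta_nat_mul_eq (k : ℕ) (z : ℂ) :
    ModularForm.eta (k * z) =
      Complex.exp (2 * Real.pi * Complex.I * z / 24) ^ k * eulerProd (nome z ^ k) := by
  rw [eta_eq, nome_nat_mul, ← Complex.exp_nat_mul]
  congr 2
  ring

theorem nome_ne_zero (z : ℂ) : nome z ≠ 0 := Complex.exp_ne_zero _

theorem nome_eq_exp_pow (z : ℂ) : nome z = Complex.exp (2 * Real.pi * Complex.I * z / 24) ^ 24 := by
  rw [nome, ← Complex.exp_nat_mul]
  congr 1
  push_cast
  ring

theorem hauptT_eq (z : ℂ) : hauptT z = (nome z)⁻¹ *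
    (eulerProd (nome z ^ 2) ^ 2 * eulerProd (nome z ^ 9) /
      (eulerProd (nome z) * eulerProd (nome z ^ 18) ^ 2)) := by
  have h2 := eta_nat_mul_eq 2 z
  have h9 := eta_nat_mul_eq 9 z
  have h18 := eta_nat_mul_eq 18 z
  push_cast at h2 h9 h18
  have he := Complex.exp_ne_zero (2 * Real.pi * Complex.I * z / 24)
  have hn : (nome z)⁻¹ = (Complex.exp (2 * Real.pi * Complex.I * z / 24) ^ 24)⁻¹ := by
    rw [nome_eq_exp_pow]
  rw [hauptT, h2, h9, h18, eta_eq, hn]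
  generalize Complex.exp (2 * Real.pi * Complex.I * z / 24) = e at he
  field_simp

theorem hauptU_eq (z : ℂ) : hauptU z = (nome z)⁻¹ *
    (eulerProd (nome z ^ 6) * eulerProd (nome z ^ 9) ^ 3 /
      (eulerProd (nome z ^ 3) * eulerProd (nome z ^ 18) ^ 3)) := by
  have h6 := eta_nat_mul_eq 6 z
  have h9 := eta_nat_mul_eq 9 z
  have h3 := eta_nat_mul_eq 3 z
  have h18 := eta_nat_mul_eq 18 z
  push_cast at h3 h6 h9 h18
  have he := Complex.exp_ne_zero (2 * Real.pi * Complex.I * z / 24)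
  have hn : (nome z)⁻¹ = (Complex.exp (2 * Real.pi * Complex.I * z / 24) ^ 24)⁻¹ := by
    rw [nome_eq_exp_pow]
  rw [hauptU, h3, h6, h9, h18, hn]
  generalize Complex.exp (2 * Real.pi * Complex.I * z / 24) = e at he
  field_simp

theorem wFun_eq_inv {z : ℂ} (hz : 0 < z.im) : wFun z = (hauptT z)⁻¹ := by
  rw [wFun_eq hz, hauptT_eq, mul_inv, inv_inv, inv_div]

/-- This is `theta_dissection` divided by q ψ(q⁹). It makes exact invariance provable without the
multiplier system of η. -/
theorem hauptT_eq_add_one {z : ℂ} (hz : 0 < z.im) : hauptT z = hauptU z + 1 := by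
  have hq := norm_nome_lt_one hz
  have hp (r : ℕ) (hr : r ≠ 0) : eulerProd (nome z ^ r) ≠ 0 :=
    eulerProd_ne_zero (norm_pow_lt_one hq hr)
  have h := theta_dissection hq (nome_ne_zero z)
  have n1 := eulerProd_ne_zero hq
  have n3 := hp 3 (by norm_num)
  have n9 := hp 9 (by norm_num)
  have n18 := hp 18 (by norm_num)
  have n0 := nome_ne_zero z
  rw [hauptT_eq, hauptU_eq]
  rw [mul_div_mul_comm, mul_comm (eulerProd (nome z ^ 2) ^ 2 / _), h]
  field_simp

theorem eta_ne_zero {z : ℂ} (hz : 0 < z.im) : ModularForm.eta z ≠ 0 := ModularForm.eta_ne_zero hz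

theorem im_nat_mul_pos {z : ℂ} (hz : 0 < z.im) {k : ℕ} (hk : k ≠ 0) : 0 < ((k : ℂ) * z).im := by
  rw [← nsmul_eq_mul, Complex.smul_im, nsmul_eq_mul]
  exact mul_pos (by exact_mod_cast Nat.pos_of_ne_zero hk) hz

theorem hauptT_ne_zero {z : ℂ} (hz : 0 < z.im) : hauptT z ≠ 0 := by
  have h (k : ℕ) (hk : k ≠ 0) := eta_ne_zero (im_nat_mul_pos hz hk)
  have h2 := h 2 (by norm_num)
  have h9 := h 9 (by norm_num)
  have h18 := h 18 (by norm_num)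
  push_cast at h2 h9 h18
  exact div_ne_zero (mul_ne_zero (pow_ne_zero _ h2) h9)
    (mul_ne_zero (eta_ne_zero hz) (pow_ne_zero _ h18))

theorem hauptU_ne_zero {z : ℂ} (hz : 0 < z.im) : hauptU z ≠ 0 := by
  have h (k : ℕ) (hk : k ≠ 0) := eta_ne_zero (im_nat_mul_pos hz hk)
  have h3 := h 3 (by norm_num)
  have h6 := h 6 (by norm_num)
  have h9 := h 9 (by norm_num)
  have h18 := h 18 (by norm_num)
  push_cast at h3 h6 h9 h18
  exact div_ne_zero (mul_ne_zero h6 (pow_ne_zero _ h9)) (mul_ne_zero h3 (pow_ne_zero _ h18))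

theorem wFun_ne_zero {z : ℂ} (hz : 0 < z.im) : wFun z ≠ 0 := by
  rw [wFun_eq_inv hz]
  exact inv_ne_zero (hauptT_ne_zero hz)

theorem differentiableAt_eta_nat_mul {z : ℂ} (hz : 0 < z.im) {k : ℕ} (hk : k ≠ 0) :
    DifferentiableAt ℂ (fun z => ModularForm.eta (k * z)) z :=
  (ModularForm.differentiableAt_eta_of_mem_upperHalfPlaneSet (im_nat_mul_pos hz hk)).comp z
    (differentiableAt_id.const_mul _)

theorem differentiableAt_hauptT {z : ℂ} (hz : 0 < z.im) : DifferentiableAt ℂ hauptT z := by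
  have h (k : ℕ) (hk : k ≠ 0) := differentiableAt_eta_nat_mul hz hk
  have h2 := h 2 (by norm_num)
  have h9 := h 9 (by norm_num)
  have h18 := h 18 (by norm_num)
  have h1 := ModularForm.differentiableAt_eta_of_mem_upperHalfPlaneSet hz
  have n18 := eta_ne_zero (im_nat_mul_pos hz (k := 18) (by norm_num))
  push_cast at h2 h9 h18 n18
  exact ((h2.pow 2).mul h9).div (h1.mul (h18.pow 2))
    (mul_ne_zero (eta_ne_zero hz) (pow_ne_zero _ n18))

theorem differentiableAt_wFun {z : ℂ} (hz : 0 < z.im) : DifferentiableAt ℂ wFun z := by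
  refine ((differentiableAt_hauptT hz).inv (hauptT_ne_zero hz)).congr_of_eventuallyEq ?_
  filter_upwards [(isOpen_lt continuous_const Complex.continuous_im).mem_nhds hz] with y hy
  exact wFun_eq_inv hy

theorem continuousAt_hauptU {z : ℂ} (hz : 0 < z.im) : ContinuousAt hauptU z := by
  refine ((differentiableAt_hauptT hz).sub_const 1).continuousAt.congr ?_
  filter_upwards [(isOpen_lt continuous_const Complex.continuous_im).mem_nhds hz] with y hy
  rw [hauptT_eq_add_one hy, add_sub_cancel_right]

/-- The filter of neighbourhoods of the cusp `i∞`. -/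
abbrev imInfty : Filter ℂ := comap Complex.im atTop

theorem tendsto_nome : Tendsto nome imInfty (𝓝 0) := by
  have h := (Function.Periodic.qParam_tendsto (h := 1) one_pos).mono_right nhdsWithin_le_nhds
  refine h.congr fun z => ?_
  simp [Function.Periodic.qParam, nome]

theorem tendsto_eulerProd : Tendsto eulerProd (𝓝 0) (𝓝 1) := by
  have h := (ModularForm.differentiableOn_tprod_one_sub_pow.differentiableAt
    (Metric.ball_mem_nhds (0 : ℂ) one_pos)).continuousAt
  have h0 : ∏' n : ℕ, (1 - (0 : ℂ) ^ (n + 1)) = 1 := by simp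
  have h1 : eulerProd = fun q => ∏' n : ℕ, (1 - q ^ (n + 1)) := funext eulerProd_eq
  rw [ContinuousAt, ← h1, h0] at h
  exact h

theorem tendsto_wFun_div_nome : Tendsto (fun z => wFun z / nome z) imInfty (𝓝 1) := by
  have h (k : ℕ) (hk : k ≠ 0) : Tendsto (fun z => eulerProd (nome z ^ k)) imInfty (𝓝 1) := by
    refine tendsto_eulerProd.comp ?_
    simpa [hk] using tendsto_nome.pow k
  have h1 : Tendsto (fun z => eulerProd (nome z)) imInfty (𝓝 1) := tendsto_eulerProd.comp tendsto_nome
  have := (h1.mul ((h 18 (by norm_num)).pow 2)).div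
    (((h 2 (by norm_num)).pow 2).mul (h 9 (by norm_num))) (by norm_num)
  norm_num at this
  refine this.congr' ?_
  filter_upwards [preimage_mem_comap (Ioi_mem_atTop (0 : ℝ))] with z hz
  rw [wFun_eq hz, mul_div_cancel_left₀ _ (nome_ne_zero z)]
  rfl

theorem tendsto_wFun : Tendsto wFun imInfty (𝓝 0) := by
  have := tendsto_wFun_div_nome.mul tendsto_nome
  rw [mul_zero] at this
  exact this.congr fun z => div_mul_cancel₀ _ (nome_ne_zero z)

end ContFracSix

namespace ContFracSix

open Filter Topology Complex

/-- The fractional linear transformation with integer coefficients `a, b, c, d`. -/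
noncomputable def mob (a b c d : ℤ) (z : ℂ) : ℂ := (a * z + b) / (c * z + d)

/-! ### Invariance of w under Γ₀(18). -/

section Mob

variable {a b c d : ℤ} {z : ℂ}

theorem mob_denom_ne_zero (h : a * d - b * c ≠ 0) (hz : 0 < z.im) : (c * z + d : ℂ) ≠ 0 := by
  intro h0
  have h1 := congrArg Complex.im h0
  have h2 := congrArg Complex.re h0
  simp at h1 h2
  rcases h1 with h1 | h1
  · rw [h1] at h2
    simp at h2
    apply h
    rw [h1, h2]
    ring
  · exact hz.ne' h1

theorem im_mob (a b c d : ℤ) (z : ℂ) :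
    (mob a b c d z).im = ((a * d - b * c : ℤ) : ℝ) * z.im / Complex.normSq (c * z + d) := by
  rw [mob, Complex.div_im]
  simp
  ring

theorem im_mob_pos (h : 0 < a * d - b * c) (hz : 0 < z.im) : 0 < (mob a b c d z).im := by
  rw [im_mob]
  have h1 : (0 : ℝ) < ((a * d - b * c : ℤ) : ℝ) := by exact_mod_cast h
  have h2 := Complex.normSq_pos.2 (mob_denom_ne_zero h.ne' hz)
  positivity

theorem coe_smul_eq_mob (g : Matrix.SpecialLinearGroup (Fin 2) ℤ) (τ : ℍ) :
    ((g • τ : ℍ) : ℂ) = mob (g 0 0) (g 0 1) (g 1 0) (g 1 1) τ := by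
  rw [UpperHalfPlane.coe_specialLinearGroup_apply, mob]
  simp

theorem exists_specialLinear (h : a * d - b * c = 1) :
    ∃ g : Matrix.SpecialLinearGroup (Fin 2) ℤ, g 0 0 = a ∧ g 0 1 = b ∧ g 1 0 = c ∧ g 1 1 = d :=
  ⟨⟨!![a, b; c, d], by rw [Matrix.det_fin_two_of, h]⟩, by simp⟩

/-- The 24th power of η is the discriminant, of weight 12 and level one. -/
theorem eta_smul_pow (g : Matrix.SpecialLinearGroup (Fin 2) ℤ) (τ : ℍ) :
    ModularForm.eta (g • τ : ℍ) ^ 24 =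
      ((g 1 0 : ℂ) * τ + (g 1 1 : ℂ)) ^ 12 * ModularForm.eta τ ^ 24 := by
  have h1 := congrFun (SlashInvariantForm.slash_action_generators_SL2Z
    ModularForm.discriminant_S_invariant ModularForm.discriminant_T_invariant g) τ
  rw [ModularForm.SL_slash_apply, ModularForm.discriminant, ModularForm.discriminant] at h1
  have hne := UpperHalfPlane.denom_ne_zero (g : GL (Fin 2) ℝ) τ
  have hd := ModularGroup.denom_apply g τ
  rw [← hd, ← h1, zpow_neg, mul_comm, mul_assoc]
  have : UpperHalfPlane.denom (g : GL (Fin 2) ℝ) τ ^ (12 : ℤ) =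
    UpperHalfPlane.denom (g : GL (Fin 2) ℝ) τ ^ 12 := zpow_natCast _ 12
  rw [this, inv_mul_cancel₀ (pow_ne_zero _ hne), mul_one]

theorem eta_mob_pow (h : a * d - b * c = 1) (hz : 0 < z.im) :
    ModularForm.eta (mob a b c d z) ^ 24 = (c * z + d) ^ 12 * ModularForm.eta z ^ 24 := by
  obtain ⟨g, rfl, rfl, rfl, rfl⟩ := exists_specialLinear h
  have := eta_smul_pow g ⟨z, hz⟩
  rwa [coe_smul_eq_mob] at this

/-- Multiplication by k conjugates the matrix to (a, kb; c/k, d), which is still integral of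
determinant 1. -/
theorem eta_nat_mul_mob_pow {k : ℕ} (hk : k ≠ 0) (hc : (k : ℤ) ∣ c) (h : a * d - b * c = 1)
    (hz : 0 < z.im) : ModularForm.eta (k * mob a b c d z) ^ 24 =
      (c * z + d) ^ 12 * ModularForm.eta (k * z) ^ 24 := by
  obtain ⟨e, rfl⟩ := hc
  have h1 := eta_mob_pow (a := a) (b := k * b) (c := e) (d := d) (z := k * z)
    (by linear_combination h) (im_nat_mul_pos hz hk)
  have h2 : mob a (k * b) e d (k * z) = k * mob a b (k * e) d z := by
    simp only [mob]
    push_cast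
    rw [← mul_div_assoc]
    congr 1 <;> ring
  rw [h2] at h1
  rw [h1]
  push_cast
  ring

theorem continuousAt_mob (h : a * d - b * c ≠ 0) (hz : 0 < z.im) :
    ContinuousAt (mob a b c d) z := by
  unfold mob
  exact ContinuousAt.div (by fun_prop) (by fun_prop) (mob_denom_ne_zero h hz)

theorem hauptT_mob_pow (hc : 18 ∣ c) (h : a * d - b * c = 1) (hz : 0 < z.im) :
    hauptT (mob a b c d z) ^ 24 = hauptT z ^ 24 := by
  have hk (k : ℕ) (hk : k ≠ 0) (hkc : (k : ℤ) ∣ 18) :=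
    eta_nat_mul_mob_pow hk (hkc.trans hc) h hz
  have h2 := hk 2 (by norm_num) (by norm_num)
  have h9 := hk 9 (by norm_num) (by norm_num)
  have h18 := hk 18 (by norm_num) (by norm_num)
  have h1 := eta_mob_pow h hz
  push_cast at h2 h9 h18
  have hne : (c * z + d : ℂ) ≠ 0 := mob_denom_ne_zero (by rw [h]; norm_num) hz
  rw [hauptT, hauptT, div_pow, div_pow, mul_pow, mul_pow, mul_pow, mul_pow, pow_right_comm _ 2 24,
    pow_right_comm _ 2 24, pow_right_comm _ 2 24, pow_right_comm _ 2 24, h2, h9, h18, h1]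
  field_simp

theorem hauptU_mob_pow (hc : 18 ∣ c) (h : a * d - b * c = 1) (hz : 0 < z.im) :
    hauptU (mob a b c d z) ^ 24 = hauptU z ^ 24 := by
  have hk (k : ℕ) (hk : k ≠ 0) (hkc : (k : ℤ) ∣ 18) :=
    eta_nat_mul_mob_pow hk (hkc.trans hc) h hz
  have h6 := hk 6 (by norm_num) (by norm_num)
  have h9 := hk 9 (by norm_num) (by norm_num)
  have h18 := hk 18 (by norm_num) (by norm_num)
  have h3 := hk 3 (by norm_num) (by norm_num)
  push_cast at h3 h6 h9 h18
  have hne : (c * z + d : ℂ) ≠ 0 := mob_denom_ne_zero (by rw [h]; norm_num) hz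
  rw [hauptU, hauptU, div_pow, div_pow, mul_pow, mul_pow, mul_pow, mul_pow, pow_right_comm _ 3 24,
    pow_right_comm _ 3 24, pow_right_comm _ 3 24, pow_right_comm _ 3 24, h3, h9, h18, h6]
  field_simp

/-- The quotient of the two functions is continuous on a connected set with values in the finite set
of 24th roots of unity. -/
theorem exists_const_of_pow_eq {f : ℂ → ℂ} (hf : ∀ z, 0 < z.im → ContinuousAt f z)
    (h0 : ∀ z, 0 < z.im → f z ≠ 0) (h : a * d - b * c = 1)
    (hpow : ∀ z, 0 < z.im → f (mob a b c d z) ^ 24 = f z ^ 24) :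
    ∃ χ : ℂ, ∀ z, 0 < z.im → f (mob a b c d z) = χ * f z := by
  have hpos : 0 < a * d - b * c := by rw [h]; norm_num
  have hcont : ContinuousOn (fun z => f (mob a b c d z) / f z) {z | 0 < z.im} := fun z hz =>
    (((hf _ (im_mob_pos hpos hz)).comp (continuousAt_mob hpos.ne' hz)).div (hf z hz)
      (h0 z hz)).continuousWithinAt
  have hfin : {x : ℂ | x ^ 24 = 1}.Finite := by
    refine ((Polynomial.nthRoots 24 (1 : ℂ)).toFinset.finite_toSet).subset fun x hx => ?_
    simpa [Polynomial.mem_nthRoots] using hx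
  have hconn : IsPreconnected {z : ℂ | 0 < z.im} := (convex_halfSpace_im_gt 0).isPreconnected
  obtain ⟨χ, -, hχ⟩ := hconn.eqOn_const_of_mapsTo (T := {x : ℂ | x ^ 24 = 1})
    hfin.isDiscrete hcont
    (fun z hz => by
      have := pow_ne_zero 24 (h0 z hz)
      rw [Set.mem_ofPred_eq, div_pow, hpow z hz, div_self this]) ⟨1, by simp⟩
  refine ⟨χ, fun z hz => ?_⟩
  have := hχ hz
  simp only [Function.const_apply] at this
  rw [← this, div_mul_cancel₀ _ (h0 z hz)]

instance : NeBot imInfty := by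
  refine comap_neBot fun t ht => ?_
  obtain ⟨y, hy⟩ := (nonempty_of_mem ht : t.Nonempty)
  exact ⟨y * Complex.I, by simpa using hy⟩

theorem eventually_im_pos : ∀ᶠ z in imInfty, 0 < z.im :=
  preimage_mem_comap (Ioi_mem_atTop (0 : ℝ))

theorem wFun_not_constant (x : ℂ) : ¬ ∀ z : ℂ, 0 < z.im → wFun z = x := by
  intro h
  have h1 : x = 0 := by
    refine tendsto_nhds_unique (tendsto_const_nhds.congr' ?_) tendsto_wFun
    filter_upwards [eventually_im_pos] with z hz using (h z hz).symm
  have h2 := h Complex.I (by simp)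
  exact wFun_ne_zero (by simp) (h2.trans h1)

/-- If T is multiplied by χ and T - 1 by ψ, then (χ - ψ) T = 1 - ψ; as T is not constant, χ = ψ = 1.
-/
theorem hauptT_mob (hc : 18 ∣ c) (h : a * d - b * c = 1) (hz : 0 < z.im) :
    hauptT (mob a b c d z) = hauptT z := by
  have hpos : 0 < a * d - b * c := by rw [h]; norm_num
  obtain ⟨χ, hχ⟩ := exists_const_of_pow_eq (fun z hz => (differentiableAt_hauptT hz).continuousAt)
    (fun z hz => hauptT_ne_zero hz) h fun z hz => hauptT_mob_pow hc h hz
  obtain ⟨ψ, hψ⟩ := exists_const_of_pow_eq (fun z hz => continuousAt_hauptU hz)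
    (fun z hz => hauptU_ne_zero hz) h fun z hz => hauptU_mob_pow hc h hz
  have key (z : ℂ) (hz : 0 < z.im) : (χ - ψ) * hauptT z = 1 - ψ := by
    have h1 := hψ z hz
    have h2 := hauptT_eq_add_one hz
    have h3 := hauptT_eq_add_one (im_mob_pos hpos hz)
    rw [hχ z hz] at h3
    linear_combination h3 - ψ * h2 + h1
  have hχψ : χ = ψ := by
    by_contra hne
    have hne' := sub_ne_zero.2 hne
    refine wFun_not_constant ((1 - ψ) / (χ - ψ))⁻¹ fun z hz => ?_
    rw [wFun_eq_inv hz, ← key z hz, mul_div_cancel_left₀ _ hne']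
  have := key z hz
  rw [hχψ, sub_self, zero_mul] at this
  rw [hχ z hz, hχψ]
  linear_combination hauptT z * this

theorem wFun_mob (hc : 18 ∣ c) (h : a * d - b * c = 1) (hz : 0 < z.im) :
    wFun (mob a b c d z) = wFun z := by
  rw [wFun_eq_inv hz, wFun_eq_inv (im_mob_pos (by rw [h]; norm_num) hz), hauptT_mob hc h hz]

end Mob

end ContFracSix

namespace ContFracSix

open Filter Topology Complex Asymptotics

/-! ### Growth of T and w at the cusps. -/

section Cusps

variable {a b c d : ℤ} {z : ℂ}

/-- Hermite normal form of an integral matrix of positive determinant. -/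
theorem exists_hermite (h : 0 < a * d - b * c) :
    ∃ a' b' c' d' A B D : ℤ, a' * d' - b' * c' = 1 ∧ 0 < A ∧ 0 < D ∧ A = Int.gcd a c ∧
      a = a' * A ∧ b = a' * B + b' * D ∧ c = c' * A ∧ d = c' * B + d' * D := by
  have hg : 0 < Int.gcd a c := by
    rw [Nat.pos_iff_ne_zero, Ne, Int.gcd_eq_zero_iff]
    rintro ⟨rfl, rfl⟩
    simp at h
  obtain ⟨a', ha⟩ := Int.gcd_dvd_left a c
  obtain ⟨c', hc⟩ := Int.gcd_dvd_right a c
  have hbez := Int.gcd_eq_gcd_ab a c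
  set g : ℤ := (Int.gcd a c : ℤ) with hgdef
  have hg' : 0 < g := by rw [hgdef]; exact_mod_cast hg
  set u := Int.gcdA a c
  set v := Int.gcdB a c
  have huv : u * a' + v * c' = 1 := by
    refine mul_left_cancel₀ hg'.ne' ?_
    linear_combination -hbez - u * ha - v * hc
  have hD : g * (-c' * b + a' * d) = a * d - b * c := by linear_combination -d * ha + b * hc
  refine ⟨a', -v, c', u, g, u * b + v * d, -c' * b + a' * d, by linear_combination huv, hg', ?_,
    rfl, by linear_combination ha, by linear_combination -b * huv, by linear_combination hc,
    by linear_combination -d * huv⟩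
  rw [← hD] at h
  exact pos_of_mul_pos_right h hg'.le

theorem mob_comp {a' b' c' d' A B D : ℤ} (hD : D ≠ 0) (ha : a = a' * A) (hb : b = a' * B + b' * D)
    (hc : c = c' * A) (hd : d = c' * B + d' * D) (z : ℂ) :
    mob a b c d z = mob a' b' c' d' (mob A B 0 D z) := by
  have hD' : (D : ℂ) ≠ 0 := by exact_mod_cast hD
  simp only [mob, ha, hb, hc, hd]
  push_cast
  have e1 : (a' : ℂ) * ((A * z + B) / (0 * z + D)) + b' = (a' * A * z + (a' * B + b' * D)) / D := by
    rw [zero_mul, zero_add]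
    field_simp
    ring
  have e2 : (c' : ℂ) * ((A * z + B) / (0 * z + D)) + d' = (c' * A * z + (c' * B + d' * D)) / D := by
    rw [zero_mul, zero_add]
    field_simp
    ring
  rw [e1, e2, div_div_div_cancel_right₀ hD']

theorem im_mob_upper {A B D : ℤ} (hD : D ≠ 0) (z : ℂ) : (mob A B 0 D z).im = A / D * z.im := by
  have hD' : (D : ℝ) ≠ 0 := by exact_mod_cast hD
  rw [im_mob]
  simp [Complex.normSq_apply]
  field_simp

theorem tendsto_mob_upper {A B D : ℤ} (hA : 0 < A) (hD : 0 < D) :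
    Tendsto (mob A B 0 D) imInfty imInfty := by
  refine tendsto_comap_iff.2 ?_
  have hA' : (0 : ℝ) < A := by exact_mod_cast hA
  have hD' : (0 : ℝ) < D := by exact_mod_cast hD
  refine (tendsto_comap.const_mul_atTop (div_pos hA' hD')).congr fun z => ?_
  rw [Function.comp_apply, im_mob_upper hD.ne']

theorem tendsto_eta_pow_div_nome :
    Tendsto (fun z => ModularForm.eta z ^ 24 / nome z) imInfty (𝓝 1) := by
  have h := (tendsto_eulerProd.comp tendsto_nome).pow 24
  rw [one_pow] at h
  refine h.congr fun z => ?_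
  rw [eta_eq, mul_pow, ← nome_eq_exp_pow, mul_div_cancel_left₀ _ (nome_ne_zero z)]
  rfl

/-- The Hermite form of (ka, kb; c, d) reduces to η at (Az + B)/D with AD = k and A = gcd(c, k),
whence the exponent A/D = gcd(c, k)²/k. -/
theorem tendsto_norm_eta_mob {k : ℕ} (hk : k ≠ 0) (h : a * d - b * c = 1) :
    ∃ C : ℝ, 0 < C ∧ Tendsto (fun z : ℂ => ‖ModularForm.eta (k * mob a b c d z)‖ ^ 24 /
      ‖(c * z + d : ℂ)‖ ^ 12 * Real.exp (2 * Real.pi * ((Int.gcd c k : ℝ) ^ 2 / k) * z.im))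
      imInfty (𝓝 C) := by
  have hk' : (0 : ℤ) < k := by exact_mod_cast Nat.pos_of_ne_zero hk
  have hdet : k * a * d - k * b * c = (k : ℤ) := by linear_combination (k : ℤ) * h
  obtain ⟨a', b', c', d', A, B, D, h', hA, hD, hAg, ha, hb, hc, hd⟩ :=
    exists_hermite (a := k * a) (b := k * b) (c := c) (d := d) (by rw [hdet]; exact hk')
  have hAD : A * D = k := by
    rw [← hdet, ha, hb, hd]
    linear_combination (-A * D) * h' + (a' * B + b' * D) * hc
  have hcop : Int.gcd a c = 1 := by
    rw [← Int.isCoprime_iff_gcd_eq_one]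
    exact ⟨d, -b, by linear_combination h⟩
  have hAc : A = Int.gcd c k := by
    rw [hAg, Int.gcd_comm]
    norm_cast
    rw [mul_comm]
    exact Int.gcd_mul_right_right_of_gcd_eq_one (by rwa [Int.gcd_comm])
  have hDR : (0 : ℝ) < D := by exact_mod_cast hD
  have hDC : (D : ℂ) ≠ 0 := by exact_mod_cast hD.ne'
  have hexp : (A : ℝ) / D = (Int.gcd c k : ℝ) ^ 2 / k := by
    have h1 : (A : ℝ) = (Int.gcd c k : ℝ) := by rw [hAc]; simp
    have h2 : (k : ℝ) = A * D := by exact_mod_cast hAD.symm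
    have h3 : (0 : ℝ) < A := by exact_mod_cast hA
    rw [← h1, h2]
    field_simp
  refine ⟨(D ^ 12)⁻¹, by positivity, ?_⟩
  have hlim := ((tendsto_eta_pow_div_nome.comp (tendsto_mob_upper (B := B) hA hD)).norm).mul_const
    (((D : ℝ) ^ 12)⁻¹)
  rw [norm_one, one_mul] at hlim
  refine hlim.congr' ?_
  filter_upwards [eventually_im_pos] with z hz
  have hne : (c * z + d : ℂ) ≠ 0 := mob_denom_ne_zero (by rw [h]; norm_num) hz
  have hw : 0 < (mob A B 0 D z).im := by
    rw [im_mob_upper hD.ne']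
    have h3 : (0 : ℝ) < A := by exact_mod_cast hA
    positivity
  have e1 : (k : ℂ) * mob a b c d z = mob a' b' c' d' (mob A B 0 D z) := by
    rw [← mob_comp hD.ne' ha hb hc hd]
    simp only [mob]
    push_cast
    rw [← mul_div_assoc]
    congr 1
    ring
  have e2 : (c' * mob A B 0 D z + d' : ℂ) = (c * z + d) / D := by
    rw [hc, hd, mob]
    push_cast
    rw [zero_mul, zero_add]
    field_simp
    ring
  rw [e1, Function.comp_apply, ← norm_pow, eta_mob_pow h' hw, e2, norm_div, norm_mul,
    norm_nome, im_mob_upper hD.ne', ← hexp, norm_pow, norm_pow, norm_div, Complex.norm_intCast,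
    abs_of_pos hDR]
  have e3 : Real.exp (-2 * Real.pi * (A / D * z.im)) =
      (Real.exp (2 * Real.pi * (A / D) * z.im))⁻¹ := by
    rw [← Real.exp_neg]
    congr 1
    ring
  rw [e3]
  have hne' : ‖(c * z + d : ℂ)‖ ≠ 0 := norm_ne_zero_iff.2 hne
  field_simp

/-- The vanishing order of `hauptT ^ 24` at the cusp with denominator `c`, in terms of the
variable at `i∞`. -/
noncomputable def cuspOrder (c : ℤ) : ℝ :=
  (Int.gcd c 2 : ℝ) ^ 2 + (Int.gcd c 9 : ℝ) ^ 2 / 9 - 1 - (Int.gcd c 18 : ℝ) ^ 2 / 9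

/-- Only gcd(c, 18) matters, which leaves a check over the divisors of 18. The value 8/3 = 24/9 is a
simple zero of T at the cusp 1/2, of width 9. -/
theorem cuspOrder_eq (hc : ¬ (18 : ℤ) ∣ c) :
    cuspOrder c = if Int.gcd c 18 = 2 then 8 / 3 else 0 := by
  have h2 : Int.gcd c 2 = Nat.gcd (Int.gcd c 18) 2 := by
    simp only [Int.gcd, Nat.gcd_assoc]
    norm_num
  have h9 : Int.gcd c 9 = Nat.gcd (Int.gcd c 18) 9 := by
    simp only [Int.gcd, Nat.gcd_assoc]
    norm_num
  have h18 : Int.gcd c 18 ≠ 18 := fun h => hc (by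
    have := Int.gcd_dvd_left c 18
    rwa [h] at this)
  have hd : Int.gcd c 18 ∣ 18 := by
    have := Int.gcd_dvd_right c 18
    exact_mod_cast this
  rw [cuspOrder, h2, h9]
  generalize Int.gcd c 18 = g at hd h18
  have : g ≤ 18 := Nat.le_of_dvd (by norm_num) hd
  interval_cases g <;>
    first | (exfalso; revert hd; decide) | (exfalso; exact h18 rfl) | norm_num

/-- The automorphy factors cancel, since T has three eta factors above and three below; the 24th
root is then taken of real norms. -/
theorem tendsto_norm_hauptT_mob (h : a * d - b * c = 1) :
    ∃ C : ℝ, 0 < C ∧ Tendsto (fun z : ℂ => ‖hauptT (mob a b c d z)‖ *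
      Real.exp (2 * Real.pi * (cuspOrder c / 24) * z.im)) imInfty (𝓝 C) := by
  obtain ⟨C₁, p₁, h₁⟩ := tendsto_norm_eta_mob (k := 1) one_ne_zero h
  obtain ⟨C₂, p₂, h₂⟩ := tendsto_norm_eta_mob (k := 2) (by norm_num) h
  obtain ⟨C₉, p₉, h₉⟩ := tendsto_norm_eta_mob (k := 9) (by norm_num) h
  obtain ⟨C₁₈, p₁₈, h₁₈⟩ := tendsto_norm_eta_mob (k := 18) (by norm_num) h
  have hlim := ((h₂.pow 2).mul h₉).div (h₁.mul (h₁₈.pow 2)) (by positivity)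
  have hpos : 0 < C₂ ^ 2 * C₉ / (C₁ * C₁₈ ^ 2) := by positivity
  refine ⟨(C₂ ^ 2 * C₉ / (C₁ * C₁₈ ^ 2)) ^ (24⁻¹ : ℝ), by positivity, ?_⟩
  refine (hlim.rpow_const (p := 24⁻¹) (Or.inl hpos.ne')).congr' ?_
  filter_upwards [eventually_im_pos] with z hz
  have hne : ‖(c * z + d : ℂ)‖ ≠ 0 :=
    norm_ne_zero_iff.2 (mob_denom_ne_zero (by rw [h]; norm_num) hz)
  refine (Real.pow_rpow_inv_natCast (n := 24) (by positivity) (by norm_num)).symm.trans ?_ |>.symm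
  push_cast
  congr 1
  rw [mul_pow, ← Real.exp_nat_mul]
  have e : Real.exp ((24 : ℕ) * (2 * Real.pi * (cuspOrder c / 24) * z.im)) =
      Real.exp (2 * Real.pi * ((Int.gcd c (2 : ℕ) : ℝ) ^ 2 / (2 : ℕ)) * z.im) ^ 2 *
      Real.exp (2 * Real.pi * ((Int.gcd c (9 : ℕ) : ℝ) ^ 2 / (9 : ℕ)) * z.im) /
      (Real.exp (2 * Real.pi * ((Int.gcd c (1 : ℕ) : ℝ) ^ 2 / (1 : ℕ)) * z.im) *
      Real.exp (2 * Real.pi * ((Int.gcd c (18 : ℕ) : ℝ) ^ 2 / (18 : ℕ)) * z.im) ^ 2) := by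
    rw [← Real.exp_nat_mul, ← Real.exp_nat_mul, ← Real.exp_add, ← Real.exp_add, ← Real.exp_sub,
      cuspOrder]
    congr 1
    push_cast
    rw [Int.gcd_one_right]
    push_cast
    ring
  rw [e, hauptT, norm_div, norm_mul, norm_mul, norm_pow, norm_pow]
  simp only [Pi.div_apply]
  push_cast
  rw [one_mul]
  have x₁ := Real.exp_ne_zero (2 * Real.pi * ((Int.gcd c 1 : ℝ) ^ 2 / 1) * z.im)
  have x₂ := Real.exp_ne_zero (2 * Real.pi * ((Int.gcd c 18 : ℝ) ^ 2 / 18) * z.im)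
  generalize Real.exp (2 * Real.pi * ((Int.gcd c 1 : ℝ) ^ 2 / 1) * z.im) = y₁ at *
  generalize Real.exp (2 * Real.pi * ((Int.gcd c 18 : ℝ) ^ 2 / 18) * z.im) = y₂ at *
  field_simp

theorem isBigO_hauptT_mob (h : a * d - b * c = 1) :
    (fun z => hauptT (mob a b c d z)) =O[imInfty]
      fun z : ℂ => Real.exp (-(2 * Real.pi * (cuspOrder c / 24)) * z.im) := by
  obtain ⟨C, -, hC⟩ := tendsto_norm_hauptT_mob h
  have h1 := (hC.isBigO_one ℝ).mul (isBigO_refl (fun z : ℂ =>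
    Real.exp (-(2 * Real.pi * (cuspOrder c / 24)) * z.im)) imInfty)
  rw [← isBigO_norm_left]
  refine h1.congr (fun z => ?_) fun z => one_mul _
  rw [mul_assoc, ← Real.exp_add]
  simp

theorem isBigO_wFun_mob (h : a * d - b * c = 1) :
    (fun z => wFun (mob a b c d z)) =O[imInfty]
      fun z : ℂ => Real.exp (2 * Real.pi * (cuspOrder c / 24) * z.im) := by
  obtain ⟨C, hC0, hC⟩ := tendsto_norm_hauptT_mob h
  have h1 := ((hC.inv₀ hC0.ne').isBigO_one ℝ).mul (isBigO_refl (fun z : ℂ =>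
    Real.exp (2 * Real.pi * (cuspOrder c / 24) * z.im)) imInfty)
  rw [← isBigO_norm_left]
  refine h1.congr' ?_ (Eventually.of_forall fun z => one_mul _)
  filter_upwards [eventually_im_pos] with z hz
  rw [wFun_eq_inv (im_mob_pos (by rw [h]; norm_num) hz), norm_inv, mul_inv, mul_assoc,
    inv_mul_cancel₀ (Real.exp_ne_zero _), mul_one]

end Cusps

end ContFracSix

namespace ContFracSix

open Filter Topology Complex Asymptotics
open scoped ModularForm MatrixGroups

/-! ### Invariant functions as polynomials in T or in w. -/

section Hauptmodul

/-- Invariance of a function on the upper half plane under `Γ₀(18)`. -/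
def IsInvariant (f : ℂ → ℂ) : Prop :=
  ∀ a b c d : ℤ, 18 ∣ c → a * d - b * c = 1 → ∀ z, 0 < z.im → f (mob a b c d z) = f z

theorem IsInvariant.add_one {f : ℂ → ℂ} (hf : IsInvariant f) {z : ℂ} (hz : 0 < z.im) :
    f (z + 1) = f z := by
  simpa [mob] using hf 1 1 0 1 (dvd_zero _) (by norm_num) z hz

theorem mob_one (z : ℂ) : mob 1 0 0 1 z = z := by simp [mob]

/-- Such a function is a modular form of weight 0 for Γ₀(18). -/
theorem exists_const_of_isInvariant {f : ℂ → ℂ} (hd : DifferentiableOn ℂ f {z | 0 < z.im})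
    (hinv : IsInvariant f)
    (hb : ∀ a b c d : ℤ, a * d - b * c = 1 →
      (fun z => f (mob a b c d z)) =O[imInfty] fun _ => (1 : ℝ)) :
    ∃ x, ∀ z : ℂ, 0 < z.im → f z = x := by
  have hfin : (CongruenceSubgroup.Gamma0 18).FiniteIndex :=
    (CongruenceSubgroup.Gamma0_is_congruence 18).finiteIndex
  have hdet (g : Matrix.SpecialLinearGroup (Fin 2) ℤ) : g 0 0 * g 1 1 - g 0 1 * g 1 0 = 1 := by
    rw [← Matrix.det_fin_two]; exact g.2
  have hslash (g : Matrix.SpecialLinearGroup (Fin 2) ℤ) (τ : ℍ) :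
      ((fun τ : ℍ => f τ) ∣[(0 : ℤ)] g) τ = f (mob (g 0 0) (g 0 1) (g 1 0) (g 1 1) τ) := by
    rw [ModularForm.SL_slash_apply, coe_smul_eq_mob]
    simp
  let F : ModularForm ((CongruenceSubgroup.Gamma0 18).map
      (Matrix.SpecialLinearGroup.mapGL ℝ)) 0 :=
    { toFun := fun τ => f τ
      slash_action_eq' := by
        rintro _ ⟨g, hg, rfl⟩
        ext τ
        refine (hslash g τ).trans (hinv _ _ _ _ ?_ (hdet g) _ τ.2)
        have := CongruenceSubgroup.Gamma0_mem.1 hg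
        exact (ZMod.intCast_zmod_eq_zero_iff_dvd _ 18).1 this
      holo' := by
        rw [UpperHalfPlane.mdifferentiable_iff]
        refine hd.congr fun z hz => ?_
        simp [UpperHalfPlane.ofComplex_apply_of_im_pos hz]
      bdd_at_cusps' := by
        intro c hc
        rw [Subgroup.IsArithmetic.isCusp_iff_isCusp_SL2Z] at hc
        rw [OnePoint.isBoundedAt_iff_forall_SL2Z hc]
        intro g _
        have := (hb _ _ _ _ (hdet g)).comp_tendsto UpperHalfPlane.tendsto_coe_atImInfty
        refine this.congr (fun τ => (hslash g τ).symm) fun _ => rfl }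
  obtain ⟨x, hx⟩ := ModularForm.eq_const_of_weight_zero F
  exact ⟨x, fun z hz => congrFun hx ⟨z, hz⟩⟩

theorem isBigO_hauptT_mob_one {a b c d : ℤ} (hc : ¬ (18 : ℤ) ∣ c) (h : a * d - b * c = 1) :
    (fun z => hauptT (mob a b c d z)) =O[imInfty] fun _ => (1 : ℝ) := by
  refine (isBigO_hauptT_mob h).trans (IsBigO.of_bound 1 ?_)
  filter_upwards [eventually_im_pos] with z hz
  rw [cuspOrder_eq hc, norm_one, one_mul, Real.norm_of_nonneg (Real.exp_pos _).le,
    Real.exp_le_one_iff]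
  have hpi := Real.pi_pos
  split_ifs
  · have := mul_pos hpi hz
    nlinarith
  · simp

theorem tendsto_hauptT_mul_nome : Tendsto (fun z => hauptT z * nome z) imInfty (𝓝 1) := by
  have := tendsto_wFun_div_nome.inv₀ one_ne_zero
  rw [inv_one] at this
  refine this.congr' ?_
  filter_upwards [eventually_im_pos] with z hz
  rw [wFun_eq_inv hz, div_eq_mul_inv, mul_inv, inv_inv, inv_inv]

theorem isBigO_hauptT_pow (K : ℕ) :
    (fun z => hauptT z ^ K) =O[imInfty] fun z : ℂ => Real.exp (2 * Real.pi * K * z.im) := by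
  have h := (isBigO_hauptT_mob (a := 1) (b := 0) (c := 0) (d := 1) (by norm_num)).pow K
  simp only [mob_one] at h
  refine h.congr_right fun z => ?_
  rw [← Real.exp_nat_mul, cuspOrder]
  congr 1
  norm_num
  ring

/-- The restriction of an invariant function to the upper half plane, multiplied by a power of the
nome, is periodic. -/
theorem periodic_indicator {f : ℂ → ℂ} (hinv : IsInvariant f) (K : ℕ) :
    Function.Periodic (fun z => if 0 < z.im then f z * nome z ^ K else 0) ((1 : ℝ) : ℂ) := by
  intro z
  have hn : nome (z + 1) = nome z := by
    rw [nome, mul_add, mul_one, Complex.exp_add, Complex.exp_two_pi_mul_I, mul_one, nome]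
  simp only [Complex.ofReal_one, Complex.add_im, Complex.one_im, add_zero, hn]
  split_ifs with h
  · rw [hinv.add_one h]
  · rfl

theorem differentiable_nome : Differentiable ℂ nome := by
  unfold nome
  fun_prop

theorem eventually_differentiableAt_indicator {f : ℂ → ℂ}
    (hd : DifferentiableOn ℂ f {z | 0 < z.im}) (K : ℕ) :
    ∀ᶠ z in imInfty,
      DifferentiableAt ℂ (fun z => if 0 < z.im then f z * nome z ^ K else 0) z := by
  filter_upwards [eventually_im_pos] with z hz
  have hnhds : {z : ℂ | 0 < z.im} ∈ 𝓝 z :=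
    (isOpen_lt continuous_const Complex.continuous_im).mem_nhds hz
  refine ((hd.differentiableAt hnhds).mul ((differentiable_nome z).pow K)).congr_of_eventuallyEq ?_
  filter_upwards [hnhds] with y hy
  exact if_pos hy

theorem indicator_eventuallyEq (f : ℂ → ℂ) (K : ℕ) :
    (fun z => if 0 < z.im then f z * nome z ^ K else 0) =ᶠ[imInfty] fun z => f z * nome z ^ K := by
  filter_upwards [eventually_im_pos] with z hz
  exact if_pos hz

theorem norm_nome_pow (z : ℂ) (K : ℕ) :
    ‖nome z ^ K‖ = Real.exp (-(2 * Real.pi * K * z.im)) := by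
  rw [norm_pow, norm_nome, ← Real.exp_nat_mul]
  congr 1
  ring

/-- A function on `X₀(18)` with a pole at most at `i∞` is a polynomial in `hauptT`. -/
theorem exists_polynomial_hauptT (K : ℕ) : ∀ f : ℂ → ℂ, DifferentiableOn ℂ f {z | 0 < z.im} →
    IsInvariant f → (∀ a b c d : ℤ, ¬ 18 ∣ c → a * d - b * c = 1 →
      (fun z => f (mob a b c d z)) =O[imInfty] fun _ => (1 : ℝ)) →
    f =O[imInfty] (fun z : ℂ => Real.exp (2 * Real.pi * K * z.im)) →
    ∃ P : ℂ[X], P.natDegree ≤ K ∧ ∀ z : ℂ, 0 < z.im → f z = P.eval (hauptT z) := by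
  induction K with
  | zero =>
    intro f hd hinv hb hO
    obtain ⟨x, hx⟩ := exists_const_of_isInvariant hd hinv fun a b c d h => by
      by_cases hc : 18 ∣ c
      · refine IsBigO.congr' (hO.trans (IsBigO.of_bound 1 (Eventually.of_forall fun z => ?_)) :
          f =O[imInfty] fun _ => (1 : ℝ)) ?_ EventuallyEq.rfl
        · simp
        · filter_upwards [eventually_im_pos] with z hz
          exact (hinv a b c d hc h z hz).symm
      · exact hb a b c d hc h
    exact ⟨C x, by simp, fun z hz => by simp [hx z hz]⟩
  | succ K ih =>
    intro f hd hinv hb hO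
    have hbd : (fun z => f z * nome z ^ (K + 1)) =O[imInfty] fun _ => (1 : ℝ) := by
      refine (hO.mul (isBigO_refl (fun z => nome z ^ (K + 1)) imInfty).norm_right).congr_right
        fun z => ?_
      rw [norm_nome_pow, ← Real.exp_add, add_neg_cancel, Real.exp_zero]
    have hlim := Function.Periodic.tendsto_at_I_inf one_pos (periodic_indicator hinv (K + 1))
      (eventually_differentiableAt_indicator hd (K + 1))
      (hbd.congr' (indicator_eventuallyEq f (K + 1)).symm EventuallyEq.rfl)
    set l := Function.Periodic.cuspFunction 1
      (fun z => if 0 < z.im then f z * nome z ^ (K + 1) else 0) 0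
    have hlim' : Tendsto (fun z => f z * nome z ^ (K + 1)) imInfty (𝓝 l) :=
      hlim.congr' (indicator_eventuallyEq f (K + 1))
    -- Here l is the coefficient of q^(-(K+1)) in f, so subtracting l T^(K+1) lowers the pole order
    -- at i∞.
    let g : ℂ → ℂ := fun z => f z - l * hauptT z ^ (K + 1)
    have hgd : DifferentiableOn ℂ g {z | 0 < z.im} := hd.sub (DifferentiableOn.const_mul
      (DifferentiableOn.pow (fun z hz => (differentiableAt_hauptT hz).differentiableWithinAt) _) _)
    have hginv : IsInvariant g := fun a b c d hc h z hz => by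
      simp only [g]
      rw [hinv a b c d hc h z hz, hauptT_mob hc h hz]
    have hgb : ∀ a b c d : ℤ, ¬ 18 ∣ c → a * d - b * c = 1 →
        (fun z => g (mob a b c d z)) =O[imInfty] fun _ => (1 : ℝ) := fun a b c d hc h =>
      (hb a b c d hc h).sub (((isBigO_hauptT_mob_one hc h).pow (K + 1)).const_mul_left l
        |>.congr_right fun _ => one_pow _)
    have hg0 : Tendsto (fun z => g z * nome z ^ (K + 1)) imInfty (𝓝 0) := by
      have := hlim'.sub ((tendsto_hauptT_mul_nome.pow (K + 1)).const_mul l)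
      rw [one_pow, mul_one, sub_self] at this
      refine this.congr fun z => ?_
      simp only [g]
      ring
    -- A function holomorphic in q that vanishes at q = 0 is O(q); this is the gain of one power
    -- needed for induction.
    have hdecay := Function.Periodic.exp_decay_of_zero_at_inf one_pos
      (periodic_indicator hginv (K + 1)) (eventually_differentiableAt_indicator hgd (K + 1))
      (hg0.congr' (indicator_eventuallyEq g (K + 1)).symm)
    have hgO : g =O[imInfty] fun z : ℂ => Real.exp (2 * Real.pi * K * z.im) := by
      have h1 := (hdecay.congr' (indicator_eventuallyEq g (K + 1)) EventuallyEq.rfl).mul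
        (isBigO_refl (fun z => (nome z ^ (K + 1))⁻¹) imInfty).norm_right
      refine h1.congr (fun z => mul_inv_cancel_right₀ (pow_ne_zero _ (nome_ne_zero z)) _)
        fun z => ?_
      rw [norm_inv, norm_nome_pow, ← Real.exp_neg, ← Real.exp_add]
      congr 1
      push_cast
      ring
    obtain ⟨P, hP, hPe⟩ := ih g hgd hginv hgb hgO
    refine ⟨P + C l * X ^ (K + 1), ?_, fun z hz => ?_⟩
    · refine (natDegree_add_le _ _).trans (max_le (hP.trans K.le_succ) ?_)
      exact natDegree_C_mul_X_pow_le _ _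
    · have := hPe z hz
      simp only [g] at this
      simp only [eval_add, eval_mul, eval_C, eval_pow, eval_X]
      linear_combination this

/-- The ring of holomorphic functions on the upper half plane that are bounded at the cusps
outside the orbit of `1/2` and of exponential growth at all cusps. -/
noncomputable def boundedSubring : Subring (ℂ → ℂ) where
  carrier := {f | DifferentiableOn ℂ f {z | 0 < z.im} ∧
    (∀ a b c d : ℤ, Int.gcd c 18 ≠ 2 → a * d - b * c = 1 →
      (fun z => f (mob a b c d z)) =O[imInfty] fun _ => (1 : ℝ)) ∧
    ∃ M : ℝ, 0 ≤ M ∧ ∀ a b c d : ℤ, a * d - b * c = 1 →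
      (fun z => f (mob a b c d z)) =O[imInfty] fun z : ℂ => Real.exp (M * z.im)}
  zero_mem' := ⟨differentiableOn_const 0, fun _ _ _ _ _ _ => isBigO_zero _ _,
    0, le_rfl, fun _ _ _ _ _ => isBigO_zero _ _⟩
  one_mem' := ⟨differentiableOn_const 1, fun _ _ _ _ _ _ => isBigO_const_const (1 : ℂ) (one_ne_zero (α := ℝ)) _,
    0, le_rfl, fun _ _ _ _ _ => by simpa using isBigO_const_const (1 : ℂ) (one_ne_zero (α := ℝ)) _⟩
  neg_mem' := by
    rintro f ⟨hd, hb, M, hM, hm⟩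
    exact ⟨hd.neg, fun a b c d hc h => (hb a b c d hc h).neg_left, M, hM,
      fun a b c d h => (hm a b c d h).neg_left⟩
  add_mem' := by
    rintro f g ⟨hd, hb, M, hM, hm⟩ ⟨hd', hb', M', hM', hm'⟩
    have hexp (M N : ℝ) (h : M ≤ N) : (fun z : ℂ => Real.exp (M * z.im)) =O[imInfty]
        fun z : ℂ => Real.exp (N * z.im) := by
      refine IsBigO.of_bound 1 ?_
      filter_upwards [eventually_im_pos] with z hz
      rw [one_mul, Real.norm_of_nonneg (Real.exp_pos _).le,
        Real.norm_of_nonneg (Real.exp_pos _).le, Real.exp_le_exp]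
      exact mul_le_mul_of_nonneg_right h hz.le
    exact ⟨hd.add hd', fun a b c d hc h => (hb a b c d hc h).add (hb' a b c d hc h), M + M',
      add_nonneg hM hM', fun a b c d h =>
      ((hm a b c d h).trans (hexp _ _ (by linarith))).add
        ((hm' a b c d h).trans (hexp _ _ (by linarith)))⟩
  mul_mem' := by
    rintro f g ⟨hd, hb, M, hM, hm⟩ ⟨hd', hb', M', hM', hm'⟩
    refine ⟨hd.mul hd', fun a b c d hc h =>
      ((hb a b c d hc h).mul (hb' a b c d hc h)).congr_right fun _ => one_mul _, M + M',
      add_nonneg hM hM', fun a b c d h =>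
      ((hm a b c d h).mul (hm' a b c d h)).congr_right fun z => ?_⟩
    rw [← Real.exp_add, add_mul]

/-- A function on `X₀(18)` with a pole at most at the cusp `1/2` is a polynomial in `w`. -/
theorem exists_polynomial_wFun {f : ℂ → ℂ} (hf : f ∈ boundedSubring) (hinv : IsInvariant f) :
    ∃ P : ℂ[X], ∀ z : ℂ, 0 < z.im → f z = P.eval (wFun z) := by
  obtain ⟨hd, hb, M, -, hm⟩ := hf
  -- At the cusp 1/2 the function T decays like exp(-(2π/9) Im z), so T^K absorbs the growth exp(M
  -- Im z) of f.
  obtain ⟨K, hK⟩ := exists_nat_ge (M / (2 * Real.pi / 9))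
  rw [div_le_iff₀ (by positivity)] at hK
  obtain ⟨P, hP, hPe⟩ := exists_polynomial_hauptT K (fun z => f z * hauptT z ^ K)
    (hd.mul (DifferentiableOn.pow
      (fun z hz => (differentiableAt_hauptT hz).differentiableWithinAt) _))
    (fun a b c d hc h z hz => by
      simp only
      rw [hinv a b c d hc h z hz, hauptT_mob hc h hz])
    (fun a b c d hc h => by
      by_cases h2 : Int.gcd c 18 = 2
      · refine ((hm a b c d h).mul ((isBigO_hauptT_mob h).pow K)).trans (IsBigO.of_bound 1 ?_)
        filter_upwards [eventually_im_pos] with z hz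
        rw [cuspOrder_eq hc, if_pos h2, norm_one, one_mul, ← Real.exp_nat_mul, ← Real.exp_add,
          Real.norm_of_nonneg (Real.exp_pos _).le, Real.exp_le_one_iff]
        have := mul_le_mul_of_nonneg_right hK hz.le
        linarith
      · exact ((hb a b c d h2 h).mul ((isBigO_hauptT_mob_one hc h).pow K)).congr_right
          fun _ => by simp)
    (by
      have h1 := hb 1 0 0 1 (by decide) (by norm_num)
      simp only [mob_one] at h1
      exact (h1.mul (isBigO_hauptT_pow K)).congr_right fun _ => one_mul _)
  -- From f = P(T) T^(-K) with deg P ≤ K, reversing P gives a polynomial in w = 1/T.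
  refine ⟨P.reflect K, fun z hz => ?_⟩
  have hT := hauptT_ne_zero hz
  let := invertibleOfNonzero hT
  have h1 := eval₂_reflect_mul_pow (RingHom.id ℂ) (hauptT z) K P hP
  rw [eval₂_id, eval₂_id, invOf_eq_inv, ← wFun_eq_inv hz, ← hPe z hz] at h1
  exact (mul_right_cancel₀ (pow_ne_zero K hT) h1).symm

end Hauptmodul

end ContFracSix

namespace ContFracSix

open Filter Topology Complex Asymptotics

/-! ### The conjugates of w(pz) and the polynomial they generate. -/

section Conjugates

theorem cuspOrder_le (c : ℤ) : cuspOrder c ≤ if Int.gcd c 18 = 2 then 8 / 3 else 0 := by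
  by_cases hc : (18 : ℤ) ∣ c
  · have h2 : Int.gcd c 2 = 2 := by
      exact_mod_cast Int.gcd_eq_right (by norm_num) ((by norm_num : (2 : ℤ) ∣ 18).trans hc)
    have h9 : Int.gcd c 9 = 9 := by
      exact_mod_cast Int.gcd_eq_right (by norm_num) ((by norm_num : (9 : ℤ) ∣ 18).trans hc)
    have h18 : Int.gcd c 18 = 18 := by exact_mod_cast Int.gcd_eq_right (by norm_num) hc
    rw [cuspOrder, h2, h9, h18]
    norm_num
  · exact (cuspOrder_eq hc).le

theorem mob_upper_mob {A B D a b c d : ℤ} {z : ℂ} (h : a * d - b * c ≠ 0) (hz : 0 < z.im) :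
    mob A B 0 D (mob a b c d z) = mob (A * a + B * c) (A * b + B * d) (D * c) (D * d) z := by
  have hne : (c * z + d : ℂ) ≠ 0 := mob_denom_ne_zero h hz
  simp only [mob]
  push_cast
  have e1 : (A : ℂ) * ((a * z + b) / (c * z + d)) + B =
      ((A * a + B * c) * z + (A * b + B * d)) / (c * z + d) := by
    rw [eq_div_iff hne, add_mul, mul_assoc, div_mul_cancel₀ _ hne]
    ring
  rw [e1, zero_mul, zero_add, div_div]
  congr 1
  ring

theorem mob_mob_inv {a b c d : ℤ} {z : ℂ} (h : a * d - b * c = 1) (hz : 0 < z.im) :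
    mob a b c d (mob d (-b) (-c) a z) = z := by
  have hne : (((-c : ℤ) : ℂ) * z + a) ≠ 0 :=
    mob_denom_ne_zero (a := d) (b := -b) (by
      have : d * a - -b * -c = 1 := by linear_combination h
      rw [this]; norm_num) hz
  have hC : (a : ℂ) * d - b * c = 1 := by exact_mod_cast h
  simp only [mob]
  push_cast at hne ⊢
  have e1 : (a : ℂ) * ((d * z + -b) / (-c * z + a)) + b = z / (-c * z + a) := by
    rw [eq_div_iff hne, add_mul, mul_assoc, div_mul_cancel₀ _ hne]
    linear_combination z * hC
  have e2 : (c : ℂ) * ((d * z + -b) / (-c * z + a)) + d = 1 / (-c * z + a) := by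
    rw [eq_div_iff hne, add_mul, mul_assoc, div_mul_cancel₀ _ hne]
    linear_combination hC
  rw [e1, e2, div_div_div_cancel_right₀ hne, div_one]

variable {p : ℕ}

/-- The upper left entry of the representatives of the cosets of degree `p`. -/
def repA : Option (Fin p) → ℤ
  | none => p
  | some _ => 1

/-- The upper right entry of the representatives of the cosets of degree `p`. -/
def repB : Option (Fin p) → ℤ
  | none => 0
  | some j => (j : ℕ)

/-- The lower right entry of the representatives of the cosets of degree `p`. -/
def repD : Option (Fin p) → ℤ
  | none => 1
  | some _ => p

/-- The conjugates of `w (p τ)` over the field generated by `w (τ)`. -/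
noncomputable def conjW (i : Option (Fin p)) (z : ℂ) : ℂ :=
  wFun (mob (repA i) (repB i) 0 (repD i) z)

theorem repA_mul_repD (i : Option (Fin p)) : repA i * repD i = p := by
  cases i <;> simp [repA, repD]

theorem repA_pos (hp : p.Prime) (i : Option (Fin p)) : 0 < repA i := by
  have := hp.pos
  cases i <;> simp [repA, this]

theorem repD_pos (hp : p.Prime) (i : Option (Fin p)) : 0 < repD i := by
  have := hp.pos
  cases i <;> simp [repD, this]

theorem conjW_none (z : ℂ) : conjW (none : Option (Fin p)) z = wFun (p * z) := by
  simp [conjW, mob, repA, repB, repD]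

theorem im_mob_rep_pos (hp : p.Prime) (i : Option (Fin p)) {z : ℂ} (hz : 0 < z.im) :
    0 < (mob (repA i) (repB i) 0 (repD i) z).im := by
  refine im_mob_pos ?_ hz
  rw [mul_zero, sub_zero]
  exact mul_pos (repA_pos hp i) (repD_pos hp i)

theorem wFun_add_int (n : ℤ) {z : ℂ} (hz : 0 < z.im) : wFun (z + n) = wFun z := by
  have := wFun_mob (a := 1) (b := n) (c := 0) (d := 1) (dvd_zero _) (by norm_num) hz
  simpa [mob] using this

/-- Since p is prime, (A, D) is (1, p) or (p, 1), and w has period 1, so B only matters modulo D. -/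
theorem exists_conjW_eq (hp : p.Prime) {A B D : ℤ} (hA : 0 < A) (hD : 0 < D) (h : A * D = p) :
    ∃ i : Option (Fin p), ∀ z : ℂ, 0 < z.im → wFun (mob A B 0 D z) = conjW i z := by
  lift A to ℕ using hA.le
  lift D to ℕ using hD.le
  have h' : A * D = p := by exact_mod_cast h
  have hp0 : (p : ℂ) ≠ 0 := by exact_mod_cast hp.ne_zero
  rcases (Nat.dvd_prime hp).1 ⟨D, h'.symm⟩ with rfl | rfl
  · rw [one_mul] at h'
    subst h'
    have hpos : (0 : ℤ) < D := by exact_mod_cast hp.pos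
    have hm : 0 ≤ B % D := Int.emod_nonneg _ hpos.ne'
    have hm' : B % D < D := Int.emod_lt_of_pos _ hpos
    refine ⟨some ⟨(B % D).toNat, by omega⟩, fun z hz => ?_⟩
    have e : mob 1 B 0 D z = mob 1 (B % D) 0 D z + ((B / D : ℤ) : ℂ) := by
      have := Int.emod_add_mul_ediv B D
      have hB : (B : ℂ) = ((B % D : ℤ) : ℂ) + D * ((B / D : ℤ) : ℂ) := by exact_mod_cast this.symm
      simp only [mob]
      push_cast
      rw [hB, zero_mul, zero_add]
      field_simp
      ring
    have him : 0 < (mob 1 (B % D) 0 D z).im := im_mob_pos (by simpa using hpos) hz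
    push_cast
    rw [e, wFun_add_int _ him, conjW]
    congr 2
    simp [repB, Int.toNat_of_nonneg hm]
  · have hD1 : D = 1 := by
      have := hp.pos
      exact Nat.eq_of_mul_eq_mul_left this (by rw [h', mul_one])
    subst hD1
    refine ⟨none, fun z hz => ?_⟩
    rw [conjW_none]
    have e : mob A B 0 (1 : ℕ) z = A * z + B := by simp [mob]
    rw [e, wFun_add_int _ (im_nat_mul_pos hz hp.ne_zero)]

theorem isCoprime_eighteen (hp : p.Prime) (h5 : 5 ≤ p) : IsCoprime (p : ℤ) 18 := by
  have h2 : Nat.Coprime p 2 := (Nat.coprime_primes hp Nat.prime_two).2 (by omega)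
  have h3 : Nat.Coprime p 3 := (Nat.coprime_primes hp Nat.prime_three).2 (by omega)
  have : Nat.Coprime p (2 * 3 ^ 2) := h2.mul_right (h3.pow_right 2)
  exact_mod_cast Nat.isCoprime_iff_coprime.2 this

/-- D and A' divide p, which is prime to 18. Thus passing to a conjugate keeps the class of a cusp
that decides about poles. -/
theorem gcd_eq_of_mul_eq (hp : p.Prime) (h5 : 5 ≤ p) {c c' A D A' D' : ℤ} (h : D * c = c' * A')
    (hAD : A * D = p) (hAD' : A' * D' = p) : Int.gcd c' 18 = Int.gcd c 18 := by
  have hcop := isCoprime_eighteen hp h5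
  have hD : Int.gcd D 18 = 1 := Int.isCoprime_iff_gcd_eq_one.1
    (hcop.of_isCoprime_of_dvd_left ⟨A, by rw [← hAD, mul_comm]⟩)
  have hA' : Int.gcd A' 18 = 1 := Int.isCoprime_iff_gcd_eq_one.1
    (hcop.of_isCoprime_of_dvd_left ⟨D', hAD'.symm⟩)
  have e1 : Int.gcd (D * c) 18 = Int.gcd c 18 := by
    simp only [Int.gcd, Int.natAbs_mul] at hD ⊢
    exact Nat.Coprime.gcd_mul_left_cancel _ hD
  have e2 : Int.gcd (c' * A') 18 = Int.gcd c' 18 := by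
    simp only [Int.gcd, Int.natAbs_mul] at hA' ⊢
    exact Nat.Coprime.gcd_mul_right_cancel _ hA'
  rw [← e1, ← e2, h]

/-- The action of a modular transformation on the cosets of degree `p`. -/
theorem exists_rep_mob (hp : p.Prime) (h5 : 5 ≤ p) (i : Option (Fin p)) {a b c d : ℤ}
    (h : a * d - b * c = 1) :
    ∃ a' b' c' d' A B D : ℤ, a' * d' - b' * c' = 1 ∧ 0 < A ∧ 0 < D ∧ A * D = p ∧
      Int.gcd c' 18 = Int.gcd c 18 ∧ ∀ z : ℂ, 0 < z.im →
        mob (repA i) (repB i) 0 (repD i) (mob a b c d z) = mob a' b' c' d' (mob A B 0 D z) := by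
  have hrep := repA_mul_repD i
  have hdet : (repA i * a + repB i * c) * (repD i * d) - (repA i * b + repB i * d) * (repD i * c) =
      p := by
    rw [← hrep]
    linear_combination repA i * repD i * h
  obtain ⟨a', b', c', d', A, B, D, h', hA, hD, -, ha, hb, hc, hd⟩ :=
    exists_hermite (by rw [hdet]; exact_mod_cast hp.pos)
  have hAD : A * D = p := by
    rw [← hdet, ha, hb, hc, hd]
    linear_combination (-A * D) * h'
  refine ⟨a', b', c', d', A, B, D, h', hA, hD, hAD, gcd_eq_of_mul_eq hp h5 hc hrep hAD,
    fun z hz => ?_⟩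
  rw [mob_upper_mob (by rw [h]; norm_num) hz]
  exact mob_comp hD.ne' ha hb hc hd z

/-- By `exists_rep_mob` a conjugate behaves at a cusp like w at a cusp with the same gcd(c, 18),
with Im z scaled by A/D ≤ p. -/
theorem conjW_mem_boundedSubring (hp : p.Prime) (h5 : 5 ≤ p) (i : Option (Fin p)) :
    conjW i ∈ boundedSubring := by
  have key (a b c d : ℤ) (h : a * d - b * c = 1) :
      (fun z => conjW i (mob a b c d z)) =O[imInfty]
        fun z : ℂ => Real.exp ((if Int.gcd c 18 = 2 then 2 * Real.pi / 9 * p else 0) * z.im) := by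
    obtain ⟨a', b', c', d', A, B, D, h', hA, hD, hAD, hg, hm⟩ := exists_rep_mob hp h5 i h
    have h1 := (isBigO_wFun_mob h').comp_tendsto (tendsto_mob_upper (B := B) hA hD)
    refine (h1.congr' ?_ EventuallyEq.rfl).trans (IsBigO.of_bound 1 ?_)
    · filter_upwards [eventually_im_pos] with z hz
      rw [Function.comp_apply, conjW, hm z hz]
    · filter_upwards [eventually_im_pos] with z hz
      rw [one_mul, Function.comp_apply, Real.norm_of_nonneg (Real.exp_pos _).le,
        Real.norm_of_nonneg (Real.exp_pos _).le, Real.exp_le_exp, im_mob_upper hD.ne', ← mul_assoc]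
      refine mul_le_mul_of_nonneg_right ?_ hz.le
      have hc := cuspOrder_le c'
      rw [hg] at hc
      have hA' : (0 : ℝ) < A := by exact_mod_cast hA
      have hD' : (1 : ℝ) ≤ D := by exact_mod_cast hD
      have hAD' : (A : ℝ) * D = p := by exact_mod_cast hAD
      have hq : (A : ℝ) / D ≤ p := by
        rw [div_le_iff₀ (by linarith), ← hAD', mul_assoc]
        nlinarith [mul_le_mul hD' hD' zero_le_one (by linarith)]
      have hq0 : (0 : ℝ) < A / D := div_pos hA' (by linarith)
      have hpi := Real.pi_pos
      calc 2 * Real.pi * (cuspOrder c' / 24) * (A / D)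
          ≤ 2 * Real.pi * ((if Int.gcd c 18 = 2 then 8 / 3 else 0) / 24) * (A / D) := by gcongr
        _ ≤ 2 * Real.pi * ((if Int.gcd c 18 = 2 then 8 / 3 else 0) / 24) * p := by
            refine mul_le_mul_of_nonneg_left hq ?_
            split_ifs <;> positivity
        _ = _ := by split_ifs <;> ring
  refine ⟨fun z hz => ?_, fun a b c d hc h => ?_, 2 * Real.pi / 9 * p, by positivity,
    fun a b c d h => (key a b c d h).trans (IsBigO.of_bound 1 ?_)⟩
  · have h1 : DifferentiableAt ℂ (mob (repA i) (repB i) 0 (repD i)) z := by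
      unfold mob
      refine DifferentiableAt.div (by fun_prop) (by fun_prop)
        (mob_denom_ne_zero (a := 1) (b := 0) ?_ hz)
      simpa using (repD_pos hp i).ne'
    exact ((differentiableAt_wFun (im_mob_rep_pos hp i hz)).comp z h1).differentiableWithinAt
  · simpa [hc] using key a b c d h
  · filter_upwards [eventually_im_pos] with z hz
    rw [one_mul, Real.norm_of_nonneg (Real.exp_pos _).le,
      Real.norm_of_nonneg (Real.exp_pos _).le, Real.exp_le_exp]
    refine mul_le_mul_of_nonneg_right ?_ hz.le
    split_ifs
    · exact le_rfl
    · positivity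

theorem exists_conjW_mob (hp : p.Prime) (h5 : 5 ≤ p) (i : Option (Fin p)) {a b c d : ℤ}
    (hc : 18 ∣ c) (h : a * d - b * c = 1) :
    ∃ i' : Option (Fin p), ∀ z : ℂ, 0 < z.im → conjW i (mob a b c d z) = conjW i' z := by
  obtain ⟨a', b', c', d', A, B, D, h', hA, hD, hAD, hg, hm⟩ := exists_rep_mob hp h5 i h
  have h18 : Int.gcd c 18 = 18 := by exact_mod_cast Int.gcd_eq_right (by norm_num) hc
  have hc' : (18 : ℤ) ∣ c' := by
    have := Int.gcd_dvd_left c' 18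
    rwa [hg, h18] at this
  obtain ⟨i', hi'⟩ := exists_conjW_eq hp (B := B) hA hD hAD
  refine ⟨i', fun z hz => ?_⟩
  rw [conjW, hm z hz, wFun_mob hc' h', hi' z hz]
  refine im_mob_pos ?_ hz
  rw [mul_zero, sub_zero]
  exact mul_pos hA hD

theorem tendsto_conjW (hp : p.Prime) (i : Option (Fin p)) : Tendsto (conjW i) imInfty (𝓝 0) :=
  tendsto_wFun.comp (tendsto_mob_upper (repA_pos hp i) (repD_pos hp i))

/-- The limit of `conjW i z / nome (z / p)` at `i∞`. -/
noncomputable def leadCoeff : Option (Fin p) → ℂ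
  | none => 0
  | some j => Complex.exp (2 * Real.pi * Complex.I / p) ^ (j : ℕ)

theorem leadCoeff_injective (hp : p.Prime) : Function.Injective (leadCoeff (p := p)) := by
  have hz := Complex.isPrimitiveRoot_exp p hp.ne_zero
  rintro (_ | j) (_ | k) h
  · rfl
  · exact absurd h.symm (pow_ne_zero _ (Complex.exp_ne_zero _))
  · exact absurd h (pow_ne_zero _ (Complex.exp_ne_zero _))
  · exact congrArg some (Fin.ext (hz.pow_inj j.2 k.2 h))

/-- In the variable t = q^(1/p), w((z + j)/p) begins with ζ^j t, while w(pz) begins with t^(p²). The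
distinct limits separate the conjugates near i∞. -/
theorem tendsto_conjW_div (hp : p.Prime) (i : Option (Fin p)) :
    Tendsto (fun z => conjW i z / nome (z / p)) imInfty (𝓝 (leadCoeff i)) := by
  have hp0 : (p : ℂ) ≠ 0 := by exact_mod_cast hp.ne_zero
  have h := tendsto_wFun_div_nome.comp
    (tendsto_mob_upper (B := repB i) (repA_pos hp i) (repD_pos hp i))
  have hn : Tendsto (fun z => nome (mob (repA i) (repB i) 0 (repD i) z) / nome (z / p)) imInfty
      (𝓝 (leadCoeff i)) := by
    rcases i with _ | j
    · have h0 : Tendsto (fun z : ℂ => nome (z / p)) imInfty (𝓝 0) := by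
        refine (tendsto_nome.comp (tendsto_mob_upper (A := 1) (B := 0) (D := p) one_pos
          (by exact_mod_cast hp.pos))).congr fun z => ?_
        simp [mob]
      have h2 : 1 < p ^ 2 := Nat.one_lt_pow two_ne_zero hp.one_lt
      have h1 := h0.pow (p ^ 2 - 1)
      rw [zero_pow (by omega)] at h1
      refine h1.congr fun z => ?_
      have e : mob (repA (none : Option (Fin p))) (repB (none : Option (Fin p))) 0
          (repD (none : Option (Fin p))) z = (p ^ 2 : ℕ) * (z / p) := by
        simp [mob, repA, repB, repD]
        field_simp
      rw [e, nome_nat_mul, eq_div_iff (nome_ne_zero _), ← pow_succ, Nat.sub_add_cancel h2.le]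
    · refine tendsto_const_nhds.congr fun z => ?_
      rw [eq_div_iff (nome_ne_zero _), leadCoeff, ← Complex.exp_nat_mul, nome, nome,
        ← Complex.exp_add]
      congr 1
      simp [mob, repA, repB, repD]
      field_simp
      ring
  have := h.mul hn
  rw [one_mul] at this
  refine this.congr fun z => ?_
  rw [Function.comp_apply, div_mul_div_cancel₀ (nome_ne_zero _)]
  rfl

theorem eventually_injective_conjW (hp : p.Prime) :
    ∀ᶠ z in imInfty, Function.Injective fun i : Option (Fin p) => conjW i z := by
  have h (i j : Option (Fin p)) (hij : i ≠ j) : ∀ᶠ z in imInfty, conjW i z ≠ conjW j z := by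
    filter_upwards [((tendsto_conjW_div hp i).sub (tendsto_conjW_div hp j)).eventually_ne
      (sub_ne_zero.2 ((leadCoeff_injective hp).ne hij))] with z hz heq
    exact hz (by rw [heq, sub_self])
  have h' : ∀ᶠ z in imInfty, ∀ i j : Option (Fin p), i ≠ j → conjW i z ≠ conjW j z := by
    refine eventually_all.2 fun i => eventually_all.2 fun j => ?_
    by_cases hij : i = j
    · simp [hij]
    · filter_upwards [h i j hij] with z hz _ using hz
  filter_upwards [h'] with z hz i j hij
  by_contra hne
  exact hz i j hne hij

theorem tendsto_coeff_prod {ι α : Type*} (s : Finset ι) {g : ι → α → ℂ} {x : ι → ℂ} {l : Filter α}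
    (h : ∀ i ∈ s, Tendsto (g i) l (𝓝 (x i))) (k : ℕ) :
    Tendsto (fun z => (∏ i ∈ s, (X - C (g i z))).coeff k) l
      (𝓝 ((∏ i ∈ s, (X - C (x i))).coeff k)) := by
  classical
  induction s using Finset.induction_on generalizing k with
  | empty => simpa using tendsto_const_nhds
  | insert i s hi ih =>
    simp only [Finset.prod_insert hi, Polynomial.coeff_mul]
    refine tendsto_finsetSum _ fun m _ => Tendsto.mul ?_
      (ih (fun j hj => h j (Finset.mem_insert_of_mem hj)) _)
    simp only [coeff_sub, coeff_X]
    refine tendsto_const_nhds.sub ?_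
    simp only [coeff_C]
    split_ifs
    · exact h i (Finset.mem_insert_self _ _)
    · exact tendsto_const_nhds

theorem prod_conjW_mob (hp : p.Prime) (h5 : 5 ≤ p) {a b c d : ℤ} (hc : 18 ∣ c)
    (h : a * d - b * c = 1) {z : ℂ} (hz : 0 < z.im) :
    ∏ i : Option (Fin p), (X - C (conjW i (mob a b c d z))) =
      ∏ i : Option (Fin p), (X - C (conjW i z)) := by
  choose σ hσ using fun i : Option (Fin p) => exists_conjW_mob hp h5 i hc h
  -- Choose y where the conjugates take distinct values and evaluate at γ⁻¹y.
  have hinj : Function.Injective σ := by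
    intro i j hij
    obtain ⟨y, hy, hyim⟩ := ((eventually_injective_conjW hp).and eventually_im_pos).exists
    refine hy ?_
    have hdet : d * a - -b * -c = 1 := by linear_combination h
    have hy' : 0 < (mob d (-b) (-c) a y).im := im_mob_pos (by rw [hdet]; norm_num) hyim
    have h1 := hσ i _ hy'
    rw [hij, ← hσ j _ hy', mob_mob_inv h hyim] at h1
    exact h1
  rw [← (Finite.injective_iff_bijective.1 hinj).prod_comp fun i => X - C (conjW i z)]
  exact Finset.prod_congr rfl fun i _ => by rw [hσ i z hz]

/-- The modular polynomial of degree `p + 1`. -/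
theorem exists_modular_polynomial (hp : p.Prime) (h5 : 5 ≤ p) :
    ∃ F : ℂ[X][Y], F.Monic ∧ F.natDegree = p + 1 ∧ (∀ k ≤ p, (F.coeff k).coeff 0 = 0) ∧
      ∀ z : ℂ, 0 < z.im → F.map (evalRingHom (wFun z)) =
        ∏ i : Option (Fin p), (X - C (conjW i z)) := by
  -- Forming the product over `boundedSubring` gives the analytic conditions for all coefficients at
  -- once.
  let Q : Polynomial boundedSubring :=
    ∏ i : Option (Fin p), (X - C ⟨conjW i, conjW_mem_boundedSubring hp h5 i⟩)
  have hQ (z : ℂ) : Q.map ((Pi.evalRingHom _ z).comp boundedSubring.subtype) =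
      ∏ i : Option (Fin p), (X - C (conjW i z)) := by
    simp [Q, Polynomial.map_prod]
  have hcoeff (k : ℕ) (z : ℂ) : (Q.coeff k : ℂ → ℂ) z =
      (∏ i : Option (Fin p), (X - C (conjW i z))).coeff k := by
    rw [← hQ, coeff_map]
    rfl
  have hex (k : ℕ) : ∃ P : ℂ[X], ∀ z : ℂ, 0 < z.im →
      (∏ i : Option (Fin p), (X - C (conjW i z))).coeff k = P.eval (wFun z) := by
    obtain ⟨P, hP⟩ := exists_polynomial_wFun (Q.coeff k).2 (fun a b c d hc h z hz => by
      rw [hcoeff, hcoeff, prod_conjW_mob hp h5 hc h hz])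
    exact ⟨P, fun z hz => by rw [← hP z hz, hcoeff]⟩
  choose P hP using hex
  have hdeg : (∑ k ∈ Finset.range (p + 1), C (P k) * X ^ k : ℂ[X][Y]).degree < ((p + 1 : ℕ) : WithBot ℕ) := by
    refine (degree_sum_le _ _).trans_lt ((Finset.sup_lt_iff (WithBot.bot_lt_coe _)).2 fun k hk => ?_)
    exact (degree_C_mul_X_pow_le _ _).trans_lt (by exact_mod_cast Finset.mem_range.1 hk)
  have hck (k : ℕ) (hk : k ≤ p) :
      (X ^ (p + 1) + ∑ k ∈ Finset.range (p + 1), C (P k) * X ^ k : ℂ[X][Y]).coeff k = P k := by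
    rw [coeff_add, coeff_X_pow, if_neg (by omega), zero_add, finsetSum_coeff,
      Finset.sum_eq_single k]
    · simp
    · intro j _ hj
      rw [coeff_C_mul_X_pow, if_neg hj.symm]
    · intro h
      exact absurd (Finset.mem_range.2 (by omega)) h
  have hmonic := monic_X_pow_add hdeg
  have hnat : (X ^ (p + 1) + ∑ k ∈ Finset.range (p + 1), C (P k) * X ^ k : ℂ[X][Y]).natDegree =
      p + 1 := by
    refine natDegree_eq_of_degree_eq_some ?_
    rw [degree_add_eq_left_of_degree_lt (by rwa [degree_X_pow]), degree_X_pow]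
  refine ⟨_, hmonic, hnat, fun k hk => ?_, fun z hz => ?_⟩
  · rw [hck k hk, coeff_zero_eq_eval_zero]
    -- As z → i∞, w and all conjugates tend to 0, so the product tends to Y^(p+1) and P_k(0) = 0 for
    -- k ≤ p.
    have h1 : Tendsto (fun z => (P k).eval (wFun z)) imInfty (𝓝 ((P k).eval 0)) :=
      ((P k).continuous.tendsto 0).comp tendsto_wFun
    have h2 := tendsto_coeff_prod Finset.univ (fun (i : Option (Fin p)) _ => tendsto_conjW hp i) k
    refine tendsto_nhds_unique (h1.congr' ?_) (h2.trans ?_)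
    · filter_upwards [eventually_im_pos] with z hz
      exact (hP k z hz).symm
    · have : (∏ i : Option (Fin p), (X - C (0 : ℂ))).coeff k = 0 := by
        rw [C_0, sub_zero, Finset.prod_const, coeff_X_pow, if_neg]
        simp
        omega
      rw [this]
  · have hm : (∏ i : Option (Fin p), (X - C (conjW i z))).natDegree = p + 1 := by
      rw [natDegree_prod_of_monic _ _ fun i _ => monic_X_sub_C _]
      simp
    have hmon : (∏ i : Option (Fin p), (X - C (conjW i z))).Monic :=
      monic_prod_of_monic _ _ fun i _ => monic_X_sub_C _
    ext k
    rcases lt_trichotomy k (p + 1) with hk | rfl | hk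
    · rw [coeff_map, hck k (by omega), hP k z hz, coe_evalRingHom]
    · have h1 := hmonic.coeff_natDegree
      have h2 := hmon.coeff_natDegree
      rw [hnat] at h1
      rw [hm] at h2
      rw [coeff_map, h1, h2, map_one]
    · rw [coeff_map, coeff_eq_zero_of_natDegree_lt (by rw [hnat]; exact hk), map_zero,
        coeff_eq_zero_of_natDegree_lt (by rw [hm]; exact hk)]

end Conjugates

end ContFracSix

namespace ContFracSix

open Filter Topology Complex

/-! ### Minimality, irreducibility and symmetry over ℂ. -/

section ModularEquation

/-- The polynomial `H` vanishes at `(w (τ), w (p τ))`. -/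
def Vanishes (p : ℕ) (H : ℂ[X][Y]) : Prop :=
  ∀ z : ℂ, 0 < z.im → H.evalEval (wFun z) (wFun (p * z)) = 0

theorem isModularEquation_iff {p : ℕ} {H : ℂ[X][Y]} :
    IsModularEquation p H ↔ Irreducible H ∧ Vanishes p H :=
  and_congr_right fun _ => ⟨fun h z hz => h ⟨z, hz⟩, fun h τ => h τ τ.2⟩

/-- Near i∞ the values of w are nonzero and tend to 0, so they avoid the finitely many roots of a
nonzero polynomial. -/
theorem eq_zero_of_eventually_eval_wFun {P : ℂ[X]}
    (h : ∀ᶠ z in imInfty, P.eval (wFun z) = 0) : P = 0 := by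
  by_contra hP
  have hfin : ({x | P.eval x = 0} \ {0} : Set ℂ).Finite := by
    refine (P.roots.toFinset.finite_toSet).subset fun x hx => ?_
    simpa [hP] using hx.1
  have hnhds : ({x | P.eval x = 0} \ {0} : Set ℂ)ᶜ ∈ 𝓝 (0 : ℂ) :=
    hfin.isClosed.isOpen_compl.mem_nhds (by simp)
  obtain ⟨z, ⟨hz, hz0⟩, hzim⟩ :=
    ((h.and (tendsto_wFun.eventually_mem hnhds)).and eventually_im_pos).exists
  exact hz0 ⟨hz, wFun_ne_zero hzim⟩

variable {p : ℕ}

/-- The conjugates are permuted transitively by `Γ₀(18)`. -/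
theorem Vanishes.evalEval_conjW (hp : p.Prime) (h5 : 5 ≤ p) {H : ℂ[X][Y]} (hH : Vanishes p H)
    (i : Option (Fin p)) {z : ℂ} (hz : 0 < z.im) : H.evalEval (wFun z) (conjW i z) = 0 := by
  rcases i with _ | j
  · rw [conjW_none]
    exact hH z hz
  -- The row (18, p + 18j) completes to γ in Γ₀(18), and diag(p, 1) γ = γ' (1, j; 0, p) with γ'
  -- again in Γ₀(18). Hence γ carries w(pz) to w((z + j)/p).
  · have hcop : IsCoprime ((p : ℤ) + 18 * (j : ℕ)) 18 :=
      (isCoprime_eighteen hp h5).add_mul_left_left _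
    obtain ⟨a, b, hab⟩ := hcop
    have hdet : a * (p + 18 * (j : ℕ)) - -b * 18 = 1 := by linear_combination hab
    have him : 0 < (mob a (-b) 18 (p + 18 * (j : ℕ)) z).im := im_mob_pos (by rw [hdet]; norm_num) hz
    have him' : 0 < (mob 1 (j : ℕ) 0 p z).im := im_mob_rep_pos hp (some j) hz
    have h1 := hH _ him
    rw [wFun_mob (dvd_refl _) hdet hz, ← conjW_none, conjW,
      mob_upper_mob (by rw [hdet]; norm_num) hz] at h1
    rw [mob_comp (a' := p * a) (b' := -b - a * (j : ℕ)) (c' := 18) (d' := 1) (A := 1)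
      (B := (j : ℕ)) (D := p) (by exact_mod_cast hp.ne_zero)
      (by simp [repA, repB]) (by simp only [repA, repB]; ring) (by simp [repD])
      (by simp only [repD]; ring), wFun_mob (dvd_refl _) (by linear_combination hab) him'] at h1
    exact h1

/-- The remainder of H modulo F has degree at most p in Y, but near i∞ it has the p + 1 distinct
conjugates as roots. -/
theorem dvd_of_vanishes (hp : p.Prime) (h5 : 5 ≤ p) {F : ℂ[X][Y]} (hF : F.Monic)
    (hdeg : F.natDegree = p + 1)
    (hmap : ∀ z : ℂ, 0 < z.im → F.map (evalRingHom (wFun z)) =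
        ∏ i : Option (Fin p), (X - C (conjW i z))) {H : ℂ[X][Y]} (hH : Vanishes p H) : F ∣ H := by
  rw [← modByMonic_eq_zero_iff_dvd hF]
  have hlt : (H %ₘ F).natDegree < p + 1 := by
    rw [← hdeg]
    exact natDegree_modByMonic_lt _ hF fun h => by rw [h] at hdeg; simp at hdeg
  have hroot (i : Option (Fin p)) (z : ℂ) (hz : 0 < z.im) :
      ((H %ₘ F).map (evalRingHom (wFun z))).eval (conjW i z) = 0 := by
    have h1 := hH.evalEval_conjW hp h5 i hz
    rw [← map_evalRingHom_eval, ← modByMonic_add_div H F, Polynomial.map_add, eval_add,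
      Polynomial.map_mul, eval_mul, hmap z hz, eval_prod] at h1
    rw [Finset.prod_eq_zero (Finset.mem_univ i) (by simp), zero_mul, add_zero] at h1
    exact h1
  ext1 k
  rw [coeff_zero]
  refine eq_zero_of_eventually_eval_wFun ?_
  filter_upwards [eventually_injective_conjW hp, eventually_im_pos] with z hinj hz
  have : (H %ₘ F).map (evalRingHom (wFun z)) = 0 := by
    refine eq_zero_of_natDegree_lt_card_of_eval_eq_zero _ hinj (fun i => hroot i z hz) ?_
    rw [Fintype.card_option, Fintype.card_fin]
    exact natDegree_map_le.trans_lt hlt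
  have h2 := congrArg (fun P => Polynomial.coeff P k) this
  simpa using h2

theorem differentiableOn_evalEval (hp : p.Prime) (H : ℂ[X][Y]) :
    DifferentiableOn ℂ (fun z => H.evalEval (wFun z) (wFun (p * z))) {z | 0 < z.im} := by
  have h1 : DifferentiableOn ℂ wFun {z | 0 < z.im} := fun z hz =>
    (differentiableAt_wFun hz).differentiableWithinAt
  have h2 : DifferentiableOn ℂ (fun z => wFun (p * z)) {z | 0 < z.im} := fun z hz =>
    ((differentiableAt_wFun (im_nat_mul_pos hz hp.ne_zero)).comp z
      (differentiableAt_id.const_mul _)).differentiableWithinAt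
  have h3 : (fun z => H.evalEval (wFun z) (wFun (p * z))) = fun z =>
      ∑ k ∈ Finset.range (H.natDegree + 1), (H.coeff k).eval (wFun z) * wFun (p * z) ^ k := by
    ext z
    rw [← map_evalRingHom_eval, eval_map, eval₂_eq_sum_range]
    rfl
  rw [h3]
  refine DifferentiableOn.fun_sum fun k _ => DifferentiableOn.mul ?_ (h2.pow k)
  exact (H.coeff k).differentiable.comp_differentiableOn h1

/-- Holomorphic functions on the connected upper half plane have no zero divisors. -/
theorem Vanishes.of_mul (hp : p.Prime) {G H : ℂ[X][Y]} (h : Vanishes p (G * H)) :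
    Vanishes p G ∨ Vanishes p H := by
  have hm (K : ℂ[X][Y]) : MDifferentiable (modelWithCornersSelf ℂ ℂ) (modelWithCornersSelf ℂ ℂ)
      (fun τ : ℍ => K.evalEval (wFun τ) (wFun (p * τ))) := by
    rw [UpperHalfPlane.mdifferentiable_iff]
    refine (differentiableOn_evalEval hp K).congr fun z hz => ?_
    simp [UpperHalfPlane.ofComplex_apply_of_im_pos hz]
  have h0 := (UpperHalfPlane.mul_eq_zero_iff (hm G) (hm H)).1 (by
    ext τ
    have := h τ τ.2
    rwa [evalEval_mul] at this)
  exact h0.imp (fun h z hz => congrFun h ⟨z, hz⟩) fun h z hz => congrFun h ⟨z, hz⟩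

theorem not_isUnit_of_vanishes {H : ℂ[X][Y]} (h : Vanishes p H) : ¬ IsUnit H := by
  intro hu
  obtain ⟨K, hK⟩ := hu.exists_right_inv
  have h1 := congrArg (evalEval (wFun Complex.I) (wFun (p * Complex.I))) hK
  rw [evalEval_mul, h Complex.I (by simp), zero_mul, evalEval_one] at h1
  exact zero_ne_one h1

theorem irreducible_of_forall_dvd (hp : p.Prime) {F : ℂ[X][Y]} (hF0 : F ≠ 0) (hF : Vanishes p F)
    (hdvd : ∀ H, Vanishes p H → F ∣ H) : Irreducible F := by
  have key (A B : ℂ[X][Y]) (hAB : F = A * B) (hA : Vanishes p A) : IsUnit B := by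
    obtain ⟨K, hK⟩ := hdvd A hA
    have h1 : F * (K * B) = F * 1 := by rw [← mul_assoc, ← hK, ← hAB, mul_one]
    exact IsUnit.of_mul_eq_one K (by rw [mul_comm]; exact mul_left_cancel₀ hF0 h1)
  refine irreducible_iff.2 ⟨not_isUnit_of_vanishes hF, fun A B hAB => ?_⟩
  rw [hAB] at hF
  rcases hF.of_mul hp with h | h
  · exact Or.inr (key A B hAB h)
  · exact Or.inl (key B A (by rw [hAB, mul_comm]) h)

theorem coeff_coeff_swap (F : ℂ[X][Y]) (i j : ℕ) :
    ((Bivariate.swap F).coeff i).coeff j = (F.coeff j).coeff i := by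
  induction F using Polynomial.induction_on' with
  | add P Q hP hQ => simp [hP, hQ]
  | monomial n a =>
    induction a using Polynomial.induction_on' with
    | add P Q hP hQ => simp only [map_add, coeff_add, hP, hQ]
    | monomial m r =>
      rw [Bivariate.swap_monomial_monomial]
      simp only [coeff_monomial]
      split_ifs <;> simp_all [coeff_monomial]

/-- With ap + 18b = 1 and γ = (a, -b; 18, p), substitute γ(pz) for z. Then w(γ(pz)) = w(pz), while
pγ(pz) is the image of z under (pa, -b; 18, 1), so the second argument becomes w(z). -/
theorem Vanishes.swap (hp : p.Prime) (h5 : 5 ≤ p) {F : ℂ[X][Y]} (hF : Vanishes p F) :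
    Vanishes p (Bivariate.swap F) := by
  intro z hz
  obtain ⟨a, b, hab⟩ := isCoprime_eighteen hp h5
  have hpz := im_nat_mul_pos hz hp.ne_zero
  have hdet : a * 1 * p - -b * 18 = 1 := by linear_combination hab
  have hdet' : a * (p : ℤ) - -b * 18 = 1 := by linear_combination hab
  have hdet2 : p * a * 1 - -b * 18 = 1 := by linear_combination hab
  have h1 := hF _ (im_mob_pos (a := a) (b := -b) (c := 18) (d := p)
    (by rw [hdet']; norm_num) hpz)
  have e : (p : ℂ) * mob a (-b) 18 p (p * z) = mob (p * a) (-b) 18 1 z := by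
    have hp0 : (p : ℂ) ≠ 0 := by exact_mod_cast hp.ne_zero
    simp only [mob]
    push_cast
    rw [← mul_div_assoc, ← mul_div_mul_left _ (18 * z + 1) hp0]
    congr 1 <;> ring
  rw [e, wFun_mob (dvd_refl _) hdet' hpz, wFun_mob (dvd_refl _) hdet2 hz] at h1
  rw [← coe_aevalAeval_eq_evalEval, Bivariate.aevalAeval_swap, coe_aevalAeval_eq_evalEval]
  exact h1

/-- Existence and main properties of the modular polynomial over `ℂ`. -/
theorem exists_modular_equation (hp : p.Prime) (h5 : 5 ≤ p) :
    ∃ F : ℂ[X][Y], F.Monic ∧ F.natDegree = p + 1 ∧ (∀ k ≤ p, (F.coeff k).coeff 0 = 0) ∧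
      Vanishes p F ∧ (∀ H, Vanishes p H → F ∣ H) ∧
      ∃ c : ℂ, c ≠ 0 ∧ ∀ i j, (F.coeff i).coeff j = c * (F.coeff j).coeff i := by
  obtain ⟨F, hmonic, hdeg, hzero, hmap⟩ := exists_modular_polynomial hp h5
  have hdvd (H) (hH : Vanishes p H) : F ∣ H := dvd_of_vanishes hp h5 hmonic hdeg hmap hH
  have hF : Vanishes p F := fun z hz => by
    rw [← map_evalRingHom_eval, hmap z hz, eval_prod]
    exact Finset.prod_eq_zero (Finset.mem_univ none) (by simp [conjW_none])
  refine ⟨F, hmonic, hdeg, hzero, hF, hdvd, ?_⟩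
  obtain ⟨H, hH⟩ := hdvd _ (hF.swap hp h5)
  -- Swapping twice is the identity, so the cofactor H is a unit, that is, a nonzero constant.
  have h1 : F * (H * Bivariate.swap H) = F * 1 := by
    rw [← mul_assoc, ← hH, ← map_mul, ← hH, Bivariate.swap_swap_apply, mul_one]
  have hu : IsUnit H := IsUnit.of_mul_eq_one _ (mul_left_cancel₀ hmonic.ne_zero h1)
  obtain ⟨r, hr, rfl⟩ := Polynomial.isUnit_iff.1 hu
  obtain ⟨c, hc, rfl⟩ := Polynomial.isUnit_iff.1 hr
  refine ⟨c, hc.ne_zero, fun i j => ?_⟩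
  rw [← coeff_coeff_swap F j i, hH, coeff_mul_C, coeff_mul_C, mul_comm]

end ModularEquation

end ContFracSix

namespace ContFracSix

open Filter Topology Complex

/-! ### Rational q-expansions and linear relations between them. -/

section Rationality

/-- On the punctured unit disc, `f` is the sum of a power series with rational coefficients. -/
def IsRatSeries (f : ℂ → ℂ) : Prop :=
  ∃ a : ℕ → ℚ, ∀ q : ℂ, ‖q‖ < 1 → q ≠ 0 → HasSum (fun n => (a n : ℂ) * q ^ n) (f q)

theorem hasSum_of_forall_eq {f g : ℕ → ℂ} {a : ℂ} (h : ∀ n, f n = g n) (hg : HasSum g a) :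
    HasSum f a :=
  (funext h : f = g) ▸ hg

theorem IsRatSeries.mul {f g : ℂ → ℂ} (hf : IsRatSeries f) (hg : IsRatSeries g) :
    IsRatSeries fun q => f q * g q := by
  obtain ⟨a, ha⟩ := hf
  obtain ⟨b, hb⟩ := hg
  refine ⟨fun n => ∑ x ∈ Finset.HasAntidiagonal.antidiagonal n, a x.1 * b x.2, fun q hq hq0 => ?_⟩
  have h1 := (ha q hq hq0).summable.norm
  have h2 := (hb q hq hq0).summable.norm
  have h3 := (summable_norm_sum_mul_antidiagonal_of_summable_norm h1 h2).of_norm.hasSum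
  rw [← tsum_mul_tsum_eq_tsum_sum_antidiagonal_of_summable_norm h1 h2, (ha q hq hq0).tsum_eq,
    (hb q hq hq0).tsum_eq] at h3
  refine hasSum_of_forall_eq (fun n => ?_) h3
  push_cast
  rw [Finset.sum_mul]
  refine Finset.sum_congr rfl fun x hx => ?_
  rw [← Finset.HasAntidiagonal.mem_antidiagonal.1 hx, pow_add]
  ring

theorem isRatSeries_one : IsRatSeries fun _ => 1 := by
  refine ⟨fun n => if n = 0 then 1 else 0, fun q _ _ => ?_⟩
  convert hasSum_single (f := fun n => (((if n = 0 then 1 else 0 : ℚ)) : ℂ) * q ^ n) 0 ?_ using 1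
  · simp
  · intro n hn
    simp [hn]

theorem isRatSeries_id : IsRatSeries fun q => q := by
  refine ⟨fun n => if n = 1 then 1 else 0, fun q _ _ => ?_⟩
  convert hasSum_single (f := fun n => (((if n = 1 then 1 else 0 : ℚ)) : ℂ) * q ^ n) 1 ?_ using 1
  · simp
  · intro n hn
    simp [hn]

theorem IsRatSeries.pow {f : ℂ → ℂ} (hf : IsRatSeries f) (k : ℕ) :
    IsRatSeries fun q => f q ^ k := by
  induction k with
  | zero => simpa using isRatSeries_one
  | succ k ih => simpa only [pow_succ] using ih.mul hf

theorem IsRatSeries.comp_pow {f : ℂ → ℂ} (hf : IsRatSeries f) {k : ℕ} (hk : k ≠ 0) :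
    IsRatSeries fun q => f (q ^ k) := by
  obtain ⟨a, ha⟩ := hf
  refine ⟨fun n => if k ∣ n then a (n / k) else 0, fun q hq hq0 => ?_⟩
  have hinj : Function.Injective fun n : ℕ => k * n :=
    mul_right_injective₀ hk
  refine (hinj.hasSum_iff ?_).1 ?_
  · intro n hn
    have : ¬ k ∣ n := fun ⟨m, hm⟩ => hn ⟨m, hm.symm⟩
    simp [this]
  · have h := ha (q ^ k) (norm_pow_lt_one hq hk) (pow_ne_zero _ hq0)
    convert h using 2 with n
    simp [Nat.mul_div_cancel_left n (Nat.pos_of_ne_zero hk), pow_mul]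

/-- The theta series `∑ q ^ (n (n + 1) / 2)` as a product. -/
noncomputable def thetaProd (q : ℂ) : ℂ := eulerProd (q ^ 2) ^ 2 / eulerProd q

/-- The coefficients are the indicator of the triangular numbers: folding ℤ onto ℕ pairs equal
exponents. -/
theorem isRatSeries_thetaProd : IsRatSeries thetaProd := by
  classical
  refine ⟨fun m => if m ∈ Set.range (fun n : ℕ => (n + 1).choose 2) then 1 else 0,
    fun q hq hq0 => ?_⟩
  have hinj : Function.Injective fun n : ℕ => (n + 1).choose 2 := by
    intro m n h
    have h1 := two_mul_choose_two (m + 1)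
    have h2 := two_mul_choose_two (n + 1)
    simp only at h
    rw [h, h2] at h1
    push_cast at h1
    have h3 : ((n : ℤ) - m) * (n + m + 1) = 0 := by linear_combination h1
    rcases mul_eq_zero.1 h3 with h3 | h3 <;> omega
  refine (hinj.hasSum_iff fun m hm => by simp only [if_neg hm]; simp).1 ?_
  have h := (Equiv.addRight (1 : ℤ)).hasSum_iff.2 (hasSum_theta hq hq0)
  have h2 := (h.nat_add_neg_add_one).div_const 2
  rw [mul_div_cancel_left₀ _ two_ne_zero] at h2
  refine hasSum_of_forall_eq (fun n => ?_) h2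
  have e1 : tri ((n : ℤ) + 1) = (n + 1).choose 2 := by exact_mod_cast tri_natCast (n + 1)
  have e2 : tri (-(n : ℤ)) = (n + 1).choose 2 := by
    have a1 := two_mul_tri (-(n : ℤ))
    have a2 := two_mul_choose_two (n + 1)
    push_cast at a2
    zify
    linarith
  simp [e1, e2]

/-- A quotient of rational power series; clearing its denominator later avoids inverting a series.
-/
theorem wFun_eq_thetaProd {z : ℂ} (hz : 0 < z.im) :
    wFun z = nome z * thetaProd (nome z ^ 9) / thetaProd (nome z) := by
  have hq := norm_nome_lt_one hz
  have hp (r : ℕ) (hr : r ≠ 0) : eulerProd (nome z ^ r) ≠ 0 :=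
    eulerProd_ne_zero (norm_pow_lt_one hq hr)
  have n1 := eulerProd_ne_zero hq
  have n2 := hp 2 (by norm_num)
  have n9 := hp 9 (by norm_num)
  rw [wFun_eq hz, thetaProd, thetaProd, ← pow_mul]
  norm_num only
  field_simp

theorem thetaProd_ne_zero {q : ℂ} (hq : ‖q‖ < 1) : thetaProd q ≠ 0 :=
  div_ne_zero (pow_ne_zero _ (eulerProd_ne_zero (norm_pow_lt_one hq two_ne_zero)))
    (eulerProd_ne_zero hq)

/-- Once the earlier coefficients vanish, divide by q^n: b_n is q times a tail, which is bounded for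
|q| ≤ 1/2. Let q → 0. -/
theorem coeff_eq_zero_of_hasSum {b : ℕ → ℂ}
    (h : ∀ q : ℂ, ‖q‖ < 1 → q ≠ 0 → HasSum (fun n => b n * q ^ n) 0) (n : ℕ) : b n = 0 := by
  induction n using Nat.strong_induction_on with
  | _ n ih =>
    have hs : Summable fun m : ℕ => ‖b (m + (n + 1))‖ * (1 / 2 : ℝ) ^ m := by
      have h1 := ((summable_nat_add_iff (n + 1)).2
        (h (1 / 2) (by norm_num) (by norm_num)).summable.norm).mul_right (2 ^ (n + 1))
      refine h1.congr fun m => ?_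
      have e1 : ‖(1 / 2 : ℂ)‖ = 1 / 2 := by norm_num
      have e2 : (1 / 2 : ℝ) ^ (n + 1) * 2 ^ (n + 1) = 1 := by rw [← mul_pow]; norm_num
      rw [norm_mul, norm_pow, pow_add, e1]
      linear_combination ‖b (m + (n + 1))‖ * (1 / 2) ^ m * e2
    have key : ∀ q : ℂ, ‖q‖ ≤ 1 / 2 → q ≠ 0 →
        ‖b n‖ ≤ ‖q‖ * ∑' m : ℕ, ‖b (m + (n + 1))‖ * (1 / 2 : ℝ) ^ m := by
      intro q hq hq0
      have h1 := h q (by linarith) hq0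
      have h2 := h1.summable.sum_add_tsum_nat_add (n + 1)
      rw [h1.tsum_eq, Finset.sum_range_succ, Finset.sum_eq_zero fun k hk => by
        rw [ih k (Finset.mem_range.1 hk), zero_mul], zero_add] at h2
      have h3 : ∑' m : ℕ, b (m + (n + 1)) * q ^ (m + (n + 1)) =
          q ^ n * (q * ∑' m : ℕ, b (m + (n + 1)) * q ^ m) := by
        rw [← tsum_mul_left, ← tsum_mul_left]
        exact tsum_congr fun m => by ring
      have h4 : b n = -(q * ∑' m : ℕ, b (m + (n + 1)) * q ^ m) := by
        refine mul_left_cancel₀ (pow_ne_zero n hq0) ?_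
        rw [h3] at h2
        linear_combination h2
      rw [h4, norm_neg, norm_mul]
      refine mul_le_mul_of_nonneg_left (tsum_of_norm_bounded hs.hasSum fun m => ?_) (norm_nonneg _)
      rw [norm_mul, norm_pow]
      gcongr
    have hlim : Tendsto (fun q : ℂ => ‖q‖ * ∑' m : ℕ, ‖b (m + (n + 1))‖ * (1 / 2 : ℝ) ^ m)
        (𝓝[≠] 0) (𝓝 0) := by
      have : Tendsto (fun q : ℂ => ‖q‖ * ∑' m : ℕ, ‖b (m + (n + 1))‖ * (1 / 2 : ℝ) ^ m)
        (𝓝 0) (𝓝 (‖(0 : ℂ)‖ * ∑' m : ℕ, ‖b (m + (n + 1))‖ * (1 / 2 : ℝ) ^ m)) :=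
          (continuous_norm.mul continuous_const).tendsto 0
      rw [norm_zero, zero_mul] at this
      exact this.mono_left nhdsWithin_le_nhds
    have hle : ‖b n‖ ≤ 0 := by
      refine ge_of_tendsto hlim ?_
      filter_upwards [self_mem_nhdsWithin, nhdsWithin_le_nhds
        (Metric.closedBall_mem_nhds (0 : ℂ) (by norm_num : (0 : ℝ) < 1 / 2))] with q hq0 hq
      exact key q (by simpa using hq) hq0
    exact norm_le_zero_iff.1 hle

/-- Linear relations between rational power series are preserved by `ℚ`-linear maps on the
coefficients. -/
theorem sum_map_mul_eq_zero {ι : Type*} (s : Finset ι) {f : ι → ℂ → ℂ}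
    (hf : ∀ i ∈ s, IsRatSeries (f i)) (x : ι → ℂ) (φ : ℂ →ₗ[ℚ] ℚ)
    (h : ∀ q : ℂ, ‖q‖ < 1 → q ≠ 0 → ∑ i ∈ s, x i * f i q = 0) {q : ℂ} (hq : ‖q‖ < 1)
    (hq0 : q ≠ 0) : ∑ i ∈ s, (φ (x i) : ℂ) * f i q = 0 := by
  choose! a ha using hf
  have hsum (y : ι → ℂ) (q : ℂ) (hq : ‖q‖ < 1) (hq0 : q ≠ 0) :
      HasSum (fun n => (∑ i ∈ s, y i * a i n) * q ^ n) (∑ i ∈ s, y i * f i q) := by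
    have := hasSum_sum fun i hi => (ha i hi q hq hq0).mul_left (y i)
    refine hasSum_of_forall_eq (fun n => ?_) this
    rw [Finset.sum_mul]
    exact Finset.sum_congr rfl fun i _ => by ring
  have hzero (n : ℕ) : ∑ i ∈ s, x i * a i n = 0 :=
    coeff_eq_zero_of_hasSum (b := fun n => ∑ i ∈ s, x i * a i n) (fun q hq hq0 => by
      have := hsum x q hq hq0
      rwa [h q hq hq0] at this) n
  have hφ (n : ℕ) : ∑ i ∈ s, (φ (x i) : ℂ) * a i n = 0 := by
    have h1 := congrArg φ (hzero n)
    rw [map_sum, map_zero] at h1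
    have h2 (i : ι) : φ (x i * a i n) = φ (x i) * a i n := by
      have : x i * (a i n : ℂ) = a i n • x i := by rw [Rat.smul_def, mul_comm]
      rw [this, map_smul, smul_eq_mul, mul_comm]
    simp only [h2] at h1
    exact_mod_cast h1
  have h3 := hsum (fun i => (φ (x i) : ℂ)) q hq hq0
  simp only [hφ, zero_mul] at h3
  exact h3.unique hasSum_zero

end Rationality

end ContFracSix

namespace ContFracSix

/-! ### Descent of the modular polynomial to ℚ. -/

section RationalModel

variable {p : ℕ}

/-- The bivariate polynomial `∑ a i j X ^ i Y ^ j` over `i, j < n`. -/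
noncomputable def ofCoeffs {R : Type*} [Semiring R] (n : ℕ) (a : ℕ → ℕ → R) : R[X][Y] :=
  ∑ x ∈ Finset.range n ×ˢ Finset.range n, monomial x.2 (monomial x.1 (a x.1 x.2))

theorem coeff_coeff_ofCoeffs {R : Type*} [Semiring R] (n : ℕ) (a : ℕ → ℕ → R) (i j : ℕ) :
    ((ofCoeffs n a).coeff j).coeff i = if i < n ∧ j < n then a i j else 0 := by
  have h (x : ℕ × ℕ) : ((monomial x.2 (monomial x.1 (a x.1 x.2))).coeff j).coeff i =
      if (i, j) = x then a i j else 0 := by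
    rcases x with ⟨k, l⟩
    simp only [coeff_monomial, Prod.mk.injEq]
    split_ifs <;> simp_all [coeff_monomial, eq_comm]
  simp only [ofCoeffs, finsetSum_coeff, h, Finset.sum_ite_eq, Finset.mem_product, Finset.mem_range]

theorem evalEval_ofCoeffs (n : ℕ) (a : ℕ → ℕ → ℂ) (x y : ℂ) :
    (ofCoeffs n a).evalEval x y =
      ∑ k ∈ Finset.range n ×ˢ Finset.range n, a k.1 k.2 * (x ^ k.1 * y ^ k.2) := by
  rw [ofCoeffs, ← coe_evalEvalRingHom, map_sum]
  refine Finset.sum_congr rfl fun k _ => ?_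
  rw [coe_evalEvalRingHom, evalEval, eval_monomial, ← C_pow, eval_mul, eval_monomial, eval_C,
    mul_assoc]

theorem exists_nome_eq {q : ℂ} (hq : ‖q‖ < 1) (hq0 : q ≠ 0) : ∃ z : ℂ, 0 < z.im ∧ nome z = q := by
  have h : nome (Complex.log q / (2 * Real.pi * Complex.I)) = q := by
    rw [nome, mul_div_cancel₀ _ Complex.two_pi_I_ne_zero, Complex.exp_log hq0]
  refine ⟨_, ?_, h⟩
  have h1 := norm_nome (Complex.log q / (2 * Real.pi * Complex.I))
  rw [h] at h1
  rw [h1, Real.exp_lt_one_iff] at hq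
  nlinarith [Real.pi_pos]

/-- The part of `w ^ i` in the expansion of a modular equation, with denominators cleared. -/
noncomputable def clearedPow (n i : ℕ) (q : ℂ) : ℂ :=
  (q * thetaProd (q ^ 9)) ^ i * thetaProd q ^ (n - i)

theorem isRatSeries_clearedPow (n i : ℕ) : IsRatSeries (clearedPow n i) :=
  ((isRatSeries_id.mul (isRatSeries_thetaProd.comp_pow (by norm_num))).pow i).mul
    (isRatSeries_thetaProd.pow _)

theorem clearedPow_nome {z : ℂ} (hz : 0 < z.im) {n i : ℕ} (h : i ≤ n) :
    clearedPow n i (nome z) = wFun z ^ i * thetaProd (nome z) ^ n := by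
  have h0 := thetaProd_ne_zero (norm_nome_lt_one hz)
  rw [wFun_eq_thetaProd hz, clearedPow, div_pow, ← Nat.sub_add_cancel h, pow_add,
    Nat.add_sub_cancel]
  field_simp

/-- Applying a `ℚ`-linear form to the coefficients of a polynomial relation between `w(z)` and
`w(pz)` gives another such relation. -/
theorem Vanishes.map_coeffs (hp : p ≠ 0) {n : ℕ} {a : ℕ → ℕ → ℂ} (h : Vanishes p (ofCoeffs n a))
    (φ : ℂ →ₗ[ℚ] ℚ) : Vanishes p (ofCoeffs n fun i j => (φ (a i j) : ℂ)) := by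
  -- Multiplying by the nonvanishing ψ(q)^n ψ(q^p)^n turns the relation into one between rational
  -- power series in q.
  have hrel {z : ℂ} (hz : 0 < z.im) (b : ℕ → ℕ → ℂ) :
      ∑ k ∈ Finset.range n ×ˢ Finset.range n,
        b k.1 k.2 * (clearedPow n k.1 (nome z) * clearedPow n k.2 (nome z ^ p)) =
      (ofCoeffs n b).evalEval (wFun z) (wFun (p * z)) *
        (thetaProd (nome z) ^ n * thetaProd (nome (p * z)) ^ n) := by
    rw [evalEval_ofCoeffs, Finset.sum_mul]
    refine Finset.sum_congr rfl fun k hk => ?_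
    rw [Finset.mem_product, Finset.mem_range, Finset.mem_range] at hk
    rw [← nome_nat_mul, clearedPow_nome hz hk.1.le, clearedPow_nome (im_nat_mul_pos hz hp) hk.2.le]
    ring
  intro z hz
  have h1 := sum_map_mul_eq_zero (Finset.range n ×ˢ Finset.range n)
    (f := fun k q => clearedPow n k.1 q * clearedPow n k.2 (q ^ p))
    (fun k _ => (isRatSeries_clearedPow n k.1).mul ((isRatSeries_clearedPow n k.2).comp_pow hp))
    (fun k => a k.1 k.2) φ (fun q hq hq0 => by
      obtain ⟨z, hz, rfl⟩ := exists_nome_eq hq hq0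
      rw [hrel hz a, h z hz, zero_mul]) (norm_nome_lt_one hz) (nome_ne_zero z)
  rw [hrel hz fun i j => (φ (a i j) : ℂ)] at h1
  exact (mul_eq_zero.1 h1).resolve_right (mul_ne_zero
    (pow_ne_zero _ (thetaProd_ne_zero (norm_nome_lt_one hz)))
    (pow_ne_zero _ (thetaProd_ne_zero (norm_nome_lt_one (im_nat_mul_pos hz hp)))))

theorem map_ofCoeffs (n : ℕ) (a : ℕ → ℕ → ℚ) :
    (ofCoeffs n a).map (mapRingHom (algebraMap ℚ ℂ)) = ofCoeffs n fun i j => (a i j : ℂ) := by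
  simp [ofCoeffs, Polynomial.map_sum, map_monomial]

theorem exists_rational_modular_equation (hp : p.Prime) (h5 : 5 ≤ p) :
    ∃ F : ℚ[X][Y], F.Monic ∧ F.natDegree = p + 1 ∧ (∀ k ≤ p, (F.coeff k).coeff 0 = 0) ∧
      Vanishes p (F.map (mapRingHom (algebraMap ℚ ℂ))) ∧
      (∀ H, Vanishes p H → F.map (mapRingHom (algebraMap ℚ ℂ)) ∣ H) ∧
      ∃ c : ℚ, c ≠ 0 ∧ ∀ i j, (F.coeff i).coeff j = c * (F.coeff j).coeff i := by
  obtain ⟨F, hmonic, hdeg, hzero, hF, hdvd, c, hc, hsymm⟩ := exists_modular_equation hp h5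
  have hout (i j : ℕ) (h : ¬ (i < p + 2 ∧ j < p + 2)) : (F.coeff j).coeff i = 0 := by
    rw [not_and_or, not_lt, not_lt] at h
    rcases h with h | h
    · rw [hsymm, coeff_eq_zero_of_natDegree_lt (p := F) (by omega), coeff_zero, mul_zero]
    · rw [coeff_eq_zero_of_natDegree_lt (p := F) (by omega), coeff_zero]
  have hFa : F = ofCoeffs (p + 2) fun i j => (F.coeff j).coeff i := by
    ext j i
    rw [coeff_coeff_ofCoeffs]
    split_ifs with h
    · rfl
    · exact hout i j h
  -- φ is a ℚ-linear retraction of ℂ onto ℚ.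
  obtain ⟨φ, hφ⟩ := LinearMap.exists_leftInverse_of_injective (Algebra.linearMap ℚ ℂ)
    (LinearMap.ker_eq_bot.2 (algebraMap ℚ ℂ).injective)
  have hφ1 : φ 1 = 1 := by simpa using LinearMap.congr_fun hφ 1
  rw [hFa] at hF
  have hG := hF.map_coeffs hp.ne_zero φ
  set G := ofCoeffs (p + 2) fun i j => (φ ((F.coeff j).coeff i) : ℂ) with hGdef
  have htop : F.coeff (p + 1) = 1 := by rw [← hdeg]; exact hmonic
  -- F divides G, and φ fixes the leading coefficient 1, so F divides G - F, which has smaller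
  -- degree in Y.
  have hGF : G = F := by
    refine sub_eq_zero.1 (eq_zero_of_dvd_of_degree_lt (p := F)
      (dvd_sub (hdvd G hG) dvd_rfl) ?_)
    rw [degree_eq_natDegree hmonic.ne_zero, hdeg, degree_lt_iff_coeff_zero]
    intro j hj
    ext i
    rw [coeff_sub, coeff_sub, hGdef, coeff_coeff_ofCoeffs, coeff_zero]
    split_ifs with h
    · obtain rfl : j = p + 1 := by omega
      rw [htop, coeff_one]
      split_ifs
      · simp [hφ1]
      · simp
    · rw [hout i j h, sub_zero]
  rw [← hFa] at hF
  rw [hGdef, ← map_ofCoeffs] at hGF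
  generalize ofCoeffs (p + 2) (fun i j => φ ((F.coeff j).coeff i)) = F' at hGF
  clear hφ hFa hGdef
  subst hGF
  have hco (i j : ℕ) : ((F'.map (mapRingHom (algebraMap ℚ ℂ))).coeff j).coeff i =
      ((F'.coeff j).coeff i : ℂ) := by simp
  have hinj : Function.Injective (mapRingHom (algebraMap ℚ ℂ)) :=
    map_injective _ (algebraMap ℚ ℂ).injective
  simp only [hco] at hzero hsymm
  have htop' : (F'.coeff (p + 1)).coeff 0 = 1 := by
    have := hco 0 (p + 1)
    rw [htop, coeff_one_zero] at this
    exact_mod_cast this.symm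
  have hcq : c = (((F'.coeff 0).coeff (p + 1) : ℚ) : ℂ) := by
    rw [hsymm 0 (p + 1), htop', Rat.cast_one, mul_one]
  refine ⟨F', monic_of_injective hinj hmonic, ?_, fun k hk => by
    exact_mod_cast hzero k hk, hF, hdvd, (F'.coeff 0).coeff (p + 1), fun h => hc ?_, ?_⟩
  · rw [← natDegree_map_eq_of_injective hinj F', hdeg]
  · rw [hcq, h, Rat.cast_zero]
  · intro i j
    have := hsymm i j
    rw [hcq] at this
    exact_mod_cast this

end RationalModel

end ContFracSix

/-! ### The coefficients of the modular equation. -/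

open ContFracSix in
theorem theorem5 (p : ℕ) (hp : p.Prime) (h5 : 5 ≤ p) :
    ∃ F : ℚ[X][Y],
      IsModularEquation p (F.map (Polynomial.mapRingHom (algebraMap ℚ ℂ))) ∧
      (∀ G : ℂ[X][Y], IsModularEquation p G →
        ∃ c : ℂ, c ≠ 0 ∧ G = c • F.map (Polynomial.mapRingHom (algebraMap ℚ ℂ))) ∧
      degX F = p + 1 ∧ degY F = p + 1 ∧
      coeffXY F (p + 1) 0 ≠ 0 ∧ coeffXY F 0 (p + 1) ≠ 0 ∧
      (∀ j : ℕ, 1 ≤ j → j ≤ p + 1 →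
        coeffXY F (p + 1) j = 0 ∧ coeffXY F j (p + 1) = 0) ∧
      (∀ j : ℕ, j ≤ p → coeffXY F 0 j = 0 ∧ coeffXY F j 0 = 0) := by
  obtain ⟨F, hmonic, hdeg, hzero, hF, hdvd, c, hc, hsymm⟩ := exists_rational_modular_equation hp h5
  have hirr := irreducible_of_forall_dvd hp
    (hmonic.map (mapRingHom (algebraMap ℚ ℂ))).ne_zero hF hdvd
  have htop : F.coeff (p + 1) = 1 := by rw [← hdeg]; exact hmonic
  -- Symmetry turns monicity in Y into a statement about X^(p+1): its only coefficient is the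
  -- constant c.
  have htop' (j : ℕ) : (F.coeff j).coeff (p + 1) = if j = 0 then c else 0 := by
    rw [hsymm, htop, coeff_one, mul_ite, mul_one, mul_zero]
  refine ⟨F, isModularEquation_iff.2 ⟨hirr, hF⟩, fun G hG => ?_, ?_, hdeg, ?_, ?_, ?_, ?_⟩
  · rw [isModularEquation_iff] at hG
    obtain ⟨U, hU⟩ := hdvd G hG.2
    -- G is irreducible and a multiple of the nonunit F, so the cofactor is a nonzero constant.
    have hu := (hG.1.isUnit_or_isUnit hU).resolve_left hirr.not_isUnit
    obtain ⟨r, hr, rfl⟩ := Polynomial.isUnit_iff.1 hu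
    obtain ⟨d, hd, rfl⟩ := Polynomial.isUnit_iff.1 hr
    refine ⟨d, hd.ne_zero, ?_⟩
    ext j i
    rw [hU, coeff_mul_C, coeff_mul_C, coeff_smul, coeff_smul, smul_eq_mul, mul_comm]
  · refine le_antisymm (Finset.sup_le fun j _ => ?_) ?_
    · refine natDegree_le_iff_coeff_eq_zero.2 fun i hi => ?_
      rw [hsymm, coeff_eq_zero_of_natDegree_lt (p := F) (by omega), coeff_zero, mul_zero]
    · have h0 : (F.coeff 0).coeff (p + 1) ≠ 0 := by simpa [htop'] using hc
      refine (le_natDegree_of_ne_zero h0).trans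
        (Finset.le_sup (f := fun j => (F.coeff j).natDegree) (mem_support_iff.2 fun h => h0 ?_))
      rw [h, coeff_zero]
  · simpa [coeffXY, htop'] using hc
  · simp [coeffXY, htop]
  · intro j hj _
    have hj0 : j ≠ 0 := by omega
    simp [coeffXY, htop, htop', coeff_one, hj0]
  · intro j hj
    refine ⟨hzero j hj, ?_⟩
    rw [coeffXY, hsymm, hzero j hj, mul_zero]
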